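/- Let $0<\rho<1$. Consider two single-server queues with infinite capacity, independent exponential service times of rate $1$ at each queue, and Poisson arrivals of rate $2\rho$, each customer joining the shorter queue (either queue with probability $1/2$ if the two are equal). Let $\pi$ be the invariant probability distribution of the resulting continuous-time Markov chain $(L_1,L_2)$ on $\mathbb N^2$ (that is, the probability distribution with $\pi Q=0$, where $Q$ is its $Q$-matrix), and let $A(y)=\sum_{k\ge 0}\pi(0,k)\,y^k$. For $x\in\mathbb C$ let $p_x(Y)=Y^2-2(1+\rho)xY+(1+2\rho x)x$, and let $\mathcal C$ be the set of pairs $(y,z)\in\mathbb C^2$ such that, for some $x\in\mathbb C$, $y$ and $z$ are the two roots (with multiplicity) of $p_x$. For $(y,z)\in\mathcal C$ the chain started at $(y,z)$ is the unique sequence $(y^{(n)})_{n\in\mathbb Z}$ of complex numbers such that $y^{(0)}=y$, $y^{(1)}=z$ and, for every $n\in\mathbb Z$, $y^{(n-1)}$ and $y^{(n+1)}$ are the two (possibly equal) solutions $w$ of $(y^{(n)},w)\in\mathcal C$. Let $(u_n)_{n\in\mathbb Z}$ and $(v_n)_{n\in\mathbb Z}$ be the chains started at $(u_0,u_1)=\left(0,-\frac{1+\rho}{\rho}\right)$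 and $(v_0,v_1)=\left(\frac{2+\rho}{\rho^2},\frac1\rho\right)$ respectively. Then $u_n\ne0$ for $n\ge1$, $v_{-n}\neq 0$ for $n\ge0$, the infinite products $\prod_{n\ge1}(1-y/u_n)$ and $\prod_{n\ge0}(1-y/v_{-n})$ converge (unconditionally) for every $y\in\mathbb C$, and the second one does not vanish for $|y|<(2+\rho)/\rho^2$. Moreover, for all $y\in\mathbb C$ with $|y|<(2+\rho)/\rho^2$, the series $A(y)$ converges and $$A(y)=C\;\frac{\prod_{n=1}^{\infty}\left(1-y/u_n\right)}{\prod_{n=0}^{\infty}\left(1-y/v_{-n}\right)},$$ where $A(1)=1-\rho$ and the constant $C$, which depends only on $\rho$, is determined by this value, i.e. by $$C\;\frac{\prod_{n=1}^{\infty}\left(1-1/u_n\right)}{\prod_{n=0}^{\infty}\left(1-1/v_{-n}\right)}=1-\rho .$$ -/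

import Mathlib

namespace JSQ

/-- The `Q`-matrix of the two-queue join-the-shortest-queue process on `ℕ × ℕ`, with arrival rate
`2ρ`, unit service rates and infinite capacities. A state is `v = (L₁, L₂)`. -/
noncomputable def rateMatrix (ρ : ℝ) (v w : ℕ × ℕ) : ℝ :=
  -- an arrival joining queue 1
  (if w = (v.1 + 1, v.2) then (if v.1 < v.2 then 2 * ρ else if v.1 = v.2 then ρ else 0) else 0)
  -- an arrival joining queue 2
  + (if w = (v.1, v.2 + 1) then (if v.2 < v.1 then 2 * ρ else if v.1 = v.2 then ρ else 0) else 0)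
  -- a service completion at queue 1, then at queue 2 (possible only if the queue is not empty)
  + (if v = (w.1 + 1, w.2) then 1 else 0)
  + (if v = (w.1, w.2 + 1) then 1 else 0)
  -- the diagonal: minus the total rate out of the state
  - (if w = v then 2 * ρ + (if 0 < v.1 then 1 else 0) + (if 0 < v.2 then 1 else 0) else 0)

/-- `π` is an invariant probability distribution of the process: a probability vector
with `π Q = 0`. -/
structure IsInvariantDistribution (ρ : ℝ) (π : ℕ × ℕ → ℝ) : Prop where
  nonneg : ∀ v, 0 ≤ π v
  hasSum_one : HasSum π 1
  balance : ∀ w, HasSum (fun v => π v * rateMatrix ρ v w) 0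

/-- `A(y) = ∑ π(0,k) y^k`. -/
noncomputable def genFun (π : ℕ × ℕ → ℝ) (y : ℂ) : ℂ :=
  ∑' k : ℕ, (π (0, k) : ℂ) * y ^ k

open Polynomial in
/-- The polynomial `p_x(Y) = Y² - 2(1+ρ) x Y + (1+2ρx) x`. -/
noncomputable def kernelPoly (ρ : ℝ) (x : ℂ) : ℂ[X] :=
  X ^ 2 - C (2 * (1 + (ρ : ℂ)) * x) * X + C ((1 + 2 * (ρ : ℂ) * x) * x)

open Polynomial in
/-- The curve of pairs `(y, z)` that are, with multiplicity, the two roots of some `p_x`. -/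
def curve (ρ : ℝ) : Set (ℂ × ℂ) :=
  {p | ∃ x : ℂ, (kernelPoly ρ x).roots = {p.1, p.2}}

/-- `s` is the chain on the curve with `s 0 = y` and `s 1 = z`: for every `n`, the numbers
`s (n - 1)` and `s (n + 1)` are the two (possibly equal) solutions `w` of `(s n, w) ∈ curve ρ`. -/
structure IsChainFrom (ρ : ℝ) (y z : ℂ) (s : ℤ → ℂ) : Prop where
  zero : s 0 = y
  one : s 1 = z
  step : ∀ n : ℤ, {w : ℂ | (s n, w) ∈ curve ρ} = {s (n - 1), s (n + 1)}

/-- Equation of the curve. -/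
theorem mem_curve_iff {ρ : ℝ} (hρ : 0 < ρ) (y z : ℂ) :
    (y, z) ∈ curve ρ ↔
      2 * (1 + (ρ : ℂ)) ^ 2 * (y * z) = (y + z) * (1 + ρ + ρ * (y + z)) := by
  have h1 : (1 + (ρ : ℂ)) ≠ 0 := by
    have : (1 + ρ : ℝ) ≠ 0 := by positivity
    exact_mod_cast this
  have key : ∀ x : ℂ, (kernelPoly ρ x).roots = {y, z} ↔
      (y + z = 2 * (1 + ρ) * x ∧ y * z = (1 + 2 * ρ * x) * x) := by
    intro x
    have hq : kernelPoly ρ x = Polynomial.C 1 * Polynomial.X ^ 2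
        + Polynomial.C (-(2 * (1 + (ρ : ℂ)) * x)) * Polynomial.X
        + Polynomial.C ((1 + 2 * (ρ : ℂ) * x) * x) := by
      simp only [kernelPoly, map_neg, map_one]; ring
    rw [hq, Polynomial.roots_quadratic_eq_pair_iff_of_ne_zero one_ne_zero]
    constructor
    · rintro ⟨ha, hb⟩
      exact ⟨by linear_combination ha, by linear_combination -hb⟩
    · rintro ⟨ha, hb⟩
      exact ⟨by linear_combination ha, by linear_combination -hb⟩
  simp only [curve, Set.mem_ofPred_eq, key]
  constructor
  · rintro ⟨x, ha, hb⟩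
    rw [ha, hb]; ring
  · intro h
    refine ⟨(y + z) / (2 * (1 + ρ)), ?_, ?_⟩
    · field_simp
    · field_simp
      linear_combination h

/-- From every point of the curve there is exactly one chain. -/
theorem existsUnique_chain {ρ : ℝ} (hρ : 0 < ρ) {y z : ℂ} (h : (y, z) ∈ curve ρ) :
    ∃! s : ℤ → ℂ, IsChainFrom ρ y z s := by
  have h0 : (ρ : ℂ) ≠ 0 := by exact_mod_cast hρ.ne'
  let L : ℂ → ℂ := fun w => (2 * (1 + ρ + ρ ^ 2) * w - (1 + ρ)) / ρ
  have hL : ∀ w, ρ * L w = 2 * (1 + ρ + ρ ^ 2) * w - (1 + ρ) := fun w => by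
    simp only [L]; field_simp
  have sol : ∀ a b : ℂ, (a, b) ∈ curve ρ →
      {w : ℂ | (a, w) ∈ curve ρ} = {b, L a - b} := by
    intro a b hab
    rw [mem_curve_iff hρ] at hab
    ext w
    simp only [Set.mem_ofPred_eq, Set.mem_insert_iff, Set.mem_singleton_iff, mem_curve_iff hρ]
    rw [← sub_eq_zero (a := w) (b := b), ← sub_eq_zero (a := w) (b := L a - b), ← mul_eq_zero]
    constructor
    · intro hw
      apply mul_left_cancel₀ h0
      linear_combination hab - hw - (w - b) * hL a
    · intro hw
      linear_combination hab - ρ * hw - (w - b) * hL a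
  have symm : ∀ a b : ℂ, (a, b) ∈ curve ρ → (b, a) ∈ curve ρ := by
    intro a b hab
    rw [mem_curve_iff hρ] at hab ⊢
    linear_combination hab
  have other : ∀ a b : ℂ, (a, b) ∈ curve ρ → (a, L a - b) ∈ curve ρ := fun a b hab => by
    have : L a - b ∈ {w : ℂ | (a, w) ∈ curve ρ} := by rw [sol a b hab]; simp
    exact this
  have recur : ∀ s, IsChainFrom ρ y z s → ∀ n : ℤ, s (n - 1) + s (n + 1) = L (s n) := by
    intro s hs n
    have e := hs.step n
    have h1 : (s n, s (n - 1)) ∈ curve ρ := by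
      have : s (n - 1) ∈ {w : ℂ | (s n, w) ∈ curve ρ} := by rw [e]; simp
      exact this
    rw [sol _ _ h1] at e
    have m1 : s (n + 1) ∈ ({s (n - 1), L (s n) - s (n - 1)} : Set ℂ) := by rw [e]; simp
    have m2 : L (s n) - s (n - 1) ∈ ({s (n - 1), s (n + 1)} : Set ℂ) := by rw [← e]; simp
    simp only [Set.mem_insert_iff, Set.mem_singleton_iff] at m1 m2
    rcases m1 with m1 | m1
    · rcases m2 with m2 | m2
      · linear_combination m1 - m2
      · linear_combination -m2
    · linear_combination m1
  let T : Equiv.Perm (ℂ × ℂ) :=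
    { toFun := fun p => (p.2, L p.2 - p.1)
      invFun := fun p => (L p.1 - p.2, p.1)
      left_inv := fun p => by simp
      right_inv := fun p => by simp }
  have hT : ∀ n : ℤ, ∀ p, (T ^ (n + 1)) p = T ((T ^ n) p) := fun n p => by
    rw [add_comm, zpow_add, zpow_one, Equiv.Perm.mul_apply]
  have hT' : ∀ n : ℤ, ∀ p, (T ^ (n - 1)) p = T.symm ((T ^ n) p) := fun n p => by
    rw [Equiv.eq_symm_apply, ← hT, sub_add_cancel]
  have hC : ∀ n : ℤ, (T ^ n) (y, z) ∈ curve ρ := by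
    intro n
    induction n using Int.induction_on with
    | zero => simpa using h
    | succ k ih =>
      rw [hT]
      exact other _ _ (symm _ _ ih)
    | pred k ih =>
      rw [hT']
      exact symm _ _ (other _ _ ih)
  refine ⟨fun n => ((T ^ n) (y, z)).1, ⟨by simp, by simp [T], fun n => ?_⟩, ?_⟩
  · have e1 : ((T ^ (n + 1)) (y, z)).1 = ((T ^ n) (y, z)).2 := by rw [hT]; rfl
    have e2 : ((T ^ (n - 1)) (y, z)).1 =
        L ((T ^ n) (y, z)).1 - ((T ^ n) (y, z)).2 := by rw [hT']; rfl
    simp only [e1, e2]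
    exact (sol _ _ (hC n)).trans (Set.pair_comm _ _)
  · intro s hs
    have both : ∀ n : ℤ, (s n, s (n + 1)) = (T ^ n) (y, z) := by
      intro n
      induction n using Int.induction_on with
      | zero => simp [hs.zero, hs.one]
      | succ k ih =>
        rw [hT, ← ih]
        have := recur s hs (k + 1)
        rw [add_sub_cancel_right] at this
        exact Prod.ext rfl (eq_sub_of_add_eq' this)
      | pred k ih =>
        rw [hT', ← ih, sub_add_cancel]
        exact Prod.ext (eq_sub_of_add_eq (recur s hs _)) rfl
    funext n
    exact congrArg Prod.fst (both n)

/-- The two starting pairs lie on the curve. -/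
theorem start_mem_curve {ρ : ℝ} (hρ : 0 < ρ) :
    ((0 : ℂ), -(1 + (ρ : ℂ)) / ρ) ∈ curve ρ ∧
      ((2 + (ρ : ℂ)) / ρ ^ 2, 1 / (ρ : ℂ)) ∈ curve ρ := by
  have h0 : (ρ : ℂ) ≠ 0 := by exact_mod_cast hρ.ne'
  rw [mem_curve_iff hρ, mem_curve_iff hρ]
  constructor <;> field_simp <;> ring

end JSQ

/-! By symmetry the process folds onto the shorter queue m and the difference n, with p m n = π(m,
m+n). Let F₀(x) = ∑ p m 0 x^m. If p_x(y) = 0 with 0 ≤ x ≤ 1, y ≠ 0 and |y| < 1+2ρ, the balance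
equations give A(y)(x − y) + F₀(x)(y + ρxy − (1+ρ)x) = 0 (`kernel_equation`). When the roots of p_x
are conjugate and nonreal, eliminating F₀(x) yields an explicit relation between A(y) and A(ȳ). The
curve condition on (y, ȳ) describes an ellipse inside the disc |y| < 1+ρ, where A is known to be
holomorphic.

The quotient B = P/Q of the two products satisfies the same relation. The curve is parametrized by
(Y(t), Y(t/q)), so a half-chain consists of the values of Y along a geometric progression. Its
canonical product is therefore a pair of q-Pochhammer products in t, and t ↦ t/q changes it by a
rational factor (`zeroProd_shift`). The starting points of the chains make these factors match the
relation for A (`zeroProd_functional_equation`, `genFun_mul_eq`).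

Hence A/B is real on the ellipse and holomorphic on the disc, so it is constant
(`eq_const_of_real_on_ellipse`). The value A(1) = 1−ρ (`tsum_boundary`) fixes the constant, and
since Q has no zero for |y| < (2+ρ)/ρ², the power series converges on that larger disc
(`hasSum_of_eqOn_ball`). -/

namespace JSQ

open Filter Topology

/-! ### Chains and the second-order recurrence -/

/-- The linear recurrence satisfied by chains. -/
def IsRecurrent (ρ : ℂ) (a : ℕ → ℂ) : Prop :=
  ∀ n, ρ * (a n + a (n + 2)) = 2 * (1 + ρ + ρ ^ 2) * a (n + 1) - (1 + ρ)

/-- Vieta: for fixed first coordinate the curve equation is quadratic in the second, with leading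
coefficient ρ. -/
theorem IsChainFrom.recurrence {ρ : ℝ} (hρ : 0 < ρ) {y z : ℂ} {s : ℤ → ℂ}
    (hs : IsChainFrom ρ y z s) (n : ℤ) :
    (ρ : ℂ) * (s (n - 1) + s (n + 1)) = 2 * (1 + ρ + ρ ^ 2) * s n - (1 + ρ) := by
  have h0 : (ρ : ℂ) ≠ 0 := by exact_mod_cast hρ.ne'
  have e := hs.step n
  have mem : ∀ w, (s n, w) ∈ curve ρ ↔ w = s (n - 1) ∨ w = s (n + 1) := fun w => by
    simpa using congrArg (w ∈ ·) e
  have h1 := (mem_curve_iff hρ _ _).1 ((mem _).2 (Or.inl rfl))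
  have h2 := (mem_curve_iff hρ _ _).1 ((mem _).2 (Or.inr rfl))
  by_cases hne : s (n + 1) = s (n - 1)
  -- If the neighbours coincide, the Vieta partner of `s (n - 1)` is still a solution, so it must
  -- equal their common value.
  · have h3 : (s n, (2 * (1 + ρ + ρ ^ 2) * s n - (1 + ρ)) / ρ - s (n - 1)) ∈ curve ρ := by
      rw [mem_curve_iff hρ]
      field_simp
      linear_combination (ρ : ℂ) * h1
    rw [mem, hne, or_self, sub_eq_iff_eq_add, div_eq_iff h0] at h3
    rw [hne]
    linear_combination -h3
  · apply mul_left_cancel₀ (sub_ne_zero.2 hne)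
    linear_combination h1 - h2

theorem IsChainFrom.isRecurrent_forward {ρ : ℝ} (hρ : 0 < ρ) {y z : ℂ} {s : ℤ → ℂ}
    (hs : IsChainFrom ρ y z s) : IsRecurrent ρ (fun n => s n) := fun n => by
  have := hs.recurrence hρ (n + 1)
  rw [add_sub_cancel_right, add_assoc] at this
  push_cast
  exact this

/-- The offset 1 − n makes `s 1` the term of index 0, so both starting values remain the first two
terms and index n + 1 is `s (-n)`. -/
theorem IsChainFrom.isRecurrent_backward {ρ : ℝ} (hρ : 0 < ρ) {y z : ℂ} {s : ℤ → ℂ}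
    (hs : IsChainFrom ρ y z s) : IsRecurrent ρ (fun n => s (1 - n)) := fun n => by
  have := hs.recurrence hρ (-n)
  rw [add_comm (s _)] at this
  push_cast
  convert this using 4 <;> ring_nf

theorem IsRecurrent.im_eq_zero {ρ : ℝ} (hρ : 0 < ρ) {a : ℕ → ℂ} (ha : IsRecurrent ρ a)
    (h0 : (a 0).im = 0) (h1 : (a 1).im = 0) (n : ℕ) : (a n).im = 0 := by
  suffices h : (a n).im = 0 ∧ (a (n + 1)).im = 0 from h.1
  induction n with
  | zero => exact ⟨h0, h1⟩
  | succ k ih =>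
    refine ⟨ih.2, ?_⟩
    have h2 : (ρ : ℂ) * (a k + a (k + 2)) = ((2 * (1 + ρ + ρ ^ 2) : ℝ) : ℂ) * a (k + 1)
        - ((1 + ρ : ℝ) : ℂ) := by
      push_cast; exact ha k
    have h3 := congrArg Complex.im h2
    rw [Complex.im_ofReal_mul, Complex.sub_im, Complex.im_ofReal_mul, Complex.ofReal_im,
      Complex.add_im, ih.1, ih.2, mul_zero, sub_zero, zero_add] at h3
    exact (mul_eq_zero.1 h3).resolve_left hρ.ne'

theorem IsRecurrent.unique {ρ : ℝ} (hρ : 0 < ρ) {a b : ℕ → ℂ} (ha : IsRecurrent ρ a)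
    (hb : IsRecurrent ρ b) (h0 : a 0 = b 0) (h1 : a 1 = b 1) (n : ℕ) : a n = b n := by
  have hρ' : (ρ : ℂ) ≠ 0 := by exact_mod_cast hρ.ne'
  suffices h : a n = b n ∧ a (n + 1) = b (n + 1) from h.1
  induction n with
  | zero => exact ⟨h0, h1⟩
  | succ k ih =>
    refine ⟨ih.2, mul_left_cancel₀ hρ' ?_⟩
    have e1 := ha k
    have e2 := hb k
    rw [ih.1, ih.2] at e1
    linear_combination e1 - e2

/-- Once r n ≤ r (n+1) and r (n+1) ≥ 1, doubling amounts to (2 − ρ + 2ρ²) r (n+1) ≥ 1 + ρ, which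
holds because 1 − 2ρ + 2ρ² > 0. Only an inequality is assumed, so that the result also applies to
−Re of a chain, where the constant term has the opposite sign. -/
theorem two_pow_mul_le_of_recurrence {ρ : ℝ} (hρ : 0 < ρ) {r : ℕ → ℝ}
    (hr : ∀ n, 2 * (1 + ρ + ρ ^ 2) * r (n + 1) - (1 + ρ) ≤ ρ * (r n + r (n + 2)))
    (h0 : r 0 ≤ r 1) (h1 : 1 ≤ r 1) (n : ℕ) : 2 ^ n * r 1 ≤ r (n + 1) := by
  have step : ∀ n, r n ≤ r (n + 1) → 1 ≤ r (n + 1) → 2 * r (n + 1) ≤ r (n + 2) := by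
    intro n h h'
    have := hr n
    apply le_of_mul_le_mul_left _ hρ
    nlinarith [mul_le_mul_of_nonneg_left h hρ.le, mul_nonneg (sq_nonneg ρ) (sub_nonneg.2 h'),
      mul_nonneg (sq_nonneg (ρ - 1)) (sub_nonneg.2 h'), mul_nonneg hρ.le (sub_nonneg.2 h'),
      sq_nonneg (2 * ρ - 1), mul_nonneg (sq_nonneg (2 * ρ - 1)) (sub_nonneg.2 h')]
  have key : ∀ n, r n ≤ r (n + 1) ∧ 1 ≤ r (n + 1) ∧ 2 ^ n * r 1 ≤ r (n + 1) := by
    intro n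
    induction n with
    | zero => exact ⟨h0, h1, by simp⟩
    | succ k ih =>
      have := step k ih.1 ih.2.1
      exact ⟨by linarith [ih.2.1], by linarith [ih.2.1], by rw [pow_succ]; linarith [ih.2.2]⟩
  exact (key n).2.2

/-! ### Rational parametrization of the curve -/

/-- A rational parametrization `t ↦ (Y t, Y (t / q))` of the curve: the function `Y`. -/
noncomputable def param (ρ q t : ℂ) : ℂ :=
  -(1 + ρ) * q / (ρ * (1 + q) * (1 - q) ^ 2) * ((t - 1) * (1 - q / t))

/-- The multiplier `q` of the parametrization. -/
structure IsMultiplier (ρ : ℝ) (q : ℂ) : Prop where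
  ne_zero : q ≠ 0
  norm_lt_one : ‖q‖ < 1
  eq : (ρ : ℂ) * (q ^ 2 + 1) = 2 * (1 + ρ + ρ ^ 2) * q

/-- The multiplier is the small root of the characteristic equation of the recurrence: the quadratic
is ρ > 0 at 0 and −2 − 2ρ² < 0 at 1. -/
theorem exists_isMultiplier {ρ : ℝ} (hρ : 0 < ρ) : ∃ q, IsMultiplier ρ q := by
  have hc : ContinuousOn (fun q : ℝ => ρ * (q ^ 2 + 1) - 2 * (1 + ρ + ρ ^ 2) * q)
      (Set.Icc 0 1) := by fun_prop
  obtain ⟨q, hq, h⟩ := intermediate_value_Ioo' zero_le_one hc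
    (show (0 : ℝ) ∈ Set.Ioo _ _ from ⟨by norm_num; nlinarith, by norm_num; exact hρ⟩)
  refine ⟨q, by exact_mod_cast hq.1.ne', ?_, ?_⟩
  · rw [Complex.norm_real, Real.norm_eq_abs, abs_of_pos hq.1]
    exact hq.2
  · exact_mod_cast sub_eq_zero.1 h

namespace IsMultiplier

variable {ρ : ℝ} {q : ℂ}

theorem one_sub_ne_zero (h : IsMultiplier ρ q) : 1 - q ≠ 0 := by
  intro h'
  have := h.norm_lt_one
  rw [← sub_eq_zero.1 h'] at this
  simp at this

theorem one_add_ne_zero (h : IsMultiplier ρ q) : 1 + q ≠ 0 := by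
  intro h'
  have := h.norm_lt_one
  rw [eq_neg_of_add_eq_zero_right h'] at this
  simp at this

/-- With `param_mul`, this gives the sum and product of the two points joined to Y(t) on the curve,
which are therefore Y(qt) and Y(t/q): a step of the chain is a multiplication of t by q or 1/q. -/
theorem param_add (hρ : 0 < ρ) (h : IsMultiplier ρ q) {t : ℂ} (ht : t ≠ 0) :
    (ρ : ℂ) * (param ρ q (q * t) + param ρ q (t / q)) =
      2 * (1 + ρ + ρ ^ 2) * param ρ q t - (1 + ρ) := by
  have h0 : (ρ : ℂ) ≠ 0 := by exact_mod_cast hρ.ne'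
  have h1 := h.one_sub_ne_zero
  have h2 := h.one_add_ne_zero
  have h3 := h.ne_zero
  have e : (2 * (1 + ρ + ρ ^ 2) : ℂ) = ρ * (q ^ 2 + 1) / q := by
    rw [eq_div_iff h3, h.eq]
  rw [e]
  simp only [param]
  field_simp
  ring

theorem param_mul (hρ : 0 < ρ) (h : IsMultiplier ρ q) {t : ℂ} (ht : t ≠ 0) :
    (ρ : ℂ) * (param ρ q (q * t) * param ρ q (t / q)) =
      ρ * param ρ q t ^ 2 + (1 + ρ) * param ρ q t := by
  have h0 : (ρ : ℂ) ≠ 0 := by exact_mod_cast hρ.ne'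
  have h1 := h.one_sub_ne_zero
  have h2 := h.one_add_ne_zero
  have h3 := h.ne_zero
  simp only [param]
  field_simp
  ring

/-- The involution t ↦ q/t exchanges the two neighbours Y(qt) and Y(t/q), so a parameter can always
be chosen to make the second coordinate Y(t/q). -/
theorem param_symm (h : IsMultiplier ρ q) {t : ℂ} (ht : t ≠ 0) :
    param ρ q (q / t) = param ρ q t := by
  have h3 := h.ne_zero
  simp only [param]
  field_simp
  ring

/-- Every point of the curve is parametrized. -/
theorem exists_param (hρ : 0 < ρ) (h : IsMultiplier ρ q) {y z : ℂ} (hyz : (y, z) ∈ curve ρ) :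
    ∃ t, t ≠ 0 ∧ param ρ q t = y ∧ param ρ q (t / q) = z := by
  have h0 : (ρ : ℂ) ≠ 0 := by exact_mod_cast hρ.ne'
  have hρ1 : (1 + ρ : ℂ) ≠ 0 := by exact_mod_cast (by positivity : (1 + ρ) ≠ 0)
  have h1 := h.one_sub_ne_zero
  have h2 := h.one_add_ne_zero
  have h3 := h.ne_zero
  obtain ⟨t, ht, hty⟩ : ∃ t, t ≠ 0 ∧ param ρ q t = y := by
    set e : ℂ := -(1 + ρ) * q / (ρ * (1 + q) * (1 - q) ^ 2) with he
    have he0 : e ≠ 0 := by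
      rw [he]
      exact div_ne_zero (mul_ne_zero (neg_ne_zero.2 hρ1) h3)
        (mul_ne_zero (mul_ne_zero h0 h2) (pow_ne_zero 2 h1))
    obtain ⟨t, ht⟩ := exists_quadratic_eq_zero (b := -(e * (1 + q) + y)) (c := e * q) he0
      (by obtain ⟨s, hs⟩ := IsAlgClosed.exists_pow_nat_eq
            (discrim e (-(e * (1 + q) + y)) (e * q)) two_pos
          exact ⟨s, by rw [← hs, sq]⟩)
    have ht0 : t ≠ 0 := by
      rintro rfl
      simp [he0, h3] at ht
    refine ⟨t, ht0, ?_⟩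
    rw [param, ← he]
    field_simp
    linear_combination ht
  rw [mem_curve_iff hρ] at hyz
  have key : (z - param ρ q (t / q)) * (z - param ρ q (q * t)) = 0 := by
    apply mul_left_cancel₀ h0
    have e1 := h.param_add hρ ht
    have e2 := h.param_mul hρ ht
    rw [hty] at e1 e2
    linear_combination -hyz - z * e1 + e2
  rcases mul_eq_zero.1 key with hz | hz
  · exact ⟨t, ht, hty, (sub_eq_zero.1 hz).symm⟩
  · refine ⟨q / t, div_ne_zero h3 ht, by rw [h.param_symm ht, hty], ?_⟩
    rw [sub_eq_zero.1 hz, ← h.param_symm (mul_ne_zero h3 ht)]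
    congr 1
    field_simp

end IsMultiplier

/-- Sequences of the recurrence whose first two terms lie on the curve, in terms of the
parametrization. -/
theorem IsRecurrent.eq_param {ρ : ℝ} {q : ℂ} (hρ : 0 < ρ) (h : IsMultiplier ρ q) {a : ℕ → ℂ}
    (ha : IsRecurrent ρ a) {t : ℂ} (ht : t ≠ 0) (h0 : a 0 = param ρ q t)
    (h1 : a 1 = param ρ q (t / q)) (n : ℕ) : a n = param ρ q (t / q ^ n) := by
  have h3 := h.ne_zero
  refine ha.unique hρ (b := fun n => param ρ q (t / q ^ n)) (fun n => ?_) (by simpa using h0)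
    (by simpa using h1) n
  have := h.param_add hρ (t := t / q ^ (n + 1)) (div_ne_zero ht (pow_ne_zero _ h3))
  rw [pow_succ, ← div_div, mul_div_cancel₀ _ h3] at this
  simpa only [pow_succ, div_div] using this

/-! ### Canonical products -/

/-- The canonical product with zeros `w n`. -/
noncomputable def zeroProd (w : ℕ → ℂ) (y : ℂ) : ℂ := ∏' n, (1 - y / w n)

section zeroProd

variable {w : ℕ → ℂ}

theorem summable_norm_div (hw : Summable fun n => ‖(w n)⁻¹‖) (y : ℂ) :
    Summable fun n => ‖-(y / w n)‖ := by
  simpa [div_eq_mul_inv] using hw.mul_left ‖y‖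

theorem multipliable_one_sub_div (hw : Summable fun n => ‖(w n)⁻¹‖) (y : ℂ) :
    Multipliable fun n => 1 - y / w n := by
  simpa only [sub_eq_add_neg] using multipliable_one_add_of_summable (summable_norm_div hw y)

theorem zeroProd_ne_zero (hw : Summable fun n => ‖(w n)⁻¹‖) (h0 : ∀ n, w n ≠ 0) {y : ℂ}
    (hy : ∀ n, y ≠ w n) : zeroProd w y ≠ 0 := by
  have := tprod_one_add_ne_zero_of_summable (f := fun n => -(y / w n)) (fun n h => hy n ?_)
    (summable_norm_div hw y)
  · simpa only [zeroProd, sub_eq_add_neg] using this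
  · rw [← sub_eq_add_neg, sub_eq_zero, eq_comm, div_eq_one_iff_eq (h0 n)] at h
    exact h

theorem differentiable_zeroProd (hw : Summable fun n => ‖(w n)⁻¹‖) :
    Differentiable ℂ (zeroProd w) := by
  intro y
  set r := ‖y‖ + 1
  have hy : y ∈ Metric.ball (0 : ℂ) r := by simp [r]
  have h := Summable.hasProdLocallyUniformlyOn_nat_one_add (f := fun n (x : ℂ) => -(x / w n))
    (Metric.isOpen_ball (x := (0 : ℂ)) (ε := r)) (hw.mul_left r)
    (Eventually.of_forall fun n x hx => by
      rw [norm_neg, div_eq_mul_inv, norm_mul]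
      exact mul_le_mul_of_nonneg_right (mem_ball_zero_iff.1 hx).le (norm_nonneg _))
    (fun n => by fun_prop)
  have hd := h.differentiableOn
    (.of_forall fun _ => by simpa [Finset.prod_fn] using
      DifferentiableOn.finsetProd (fun _ _ => by fun_prop)) Metric.isOpen_ball
  have e : zeroProd w = fun x => ∏' n, (1 + -(x / w n)) := by
    funext x; simp only [zeroProd, sub_eq_add_neg]
  rw [e]
  exact hd.differentiableAt (Metric.isOpen_ball.mem_nhds hy)

theorem zeroProd_conj (hw : Summable fun n => ‖(w n)⁻¹‖) (hr : ∀ n, (w n).im = 0) (y : ℂ) :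
    zeroProd w (starRingEnd ℂ y) = starRingEnd ℂ (zeroProd w y) := by
  rw [zeroProd, zeroProd,
    (multipliable_one_sub_div hw y).map_tprod (starRingEnd ℂ) Complex.continuous_conj]
  refine tprod_congr fun n => ?_
  rw [map_sub, map_one, map_div₀, Complex.conj_eq_iff_im.2 (hr n)]

end zeroProd

/-- The `q`-Pochhammer product. -/
noncomputable def qProd (q s : ℂ) : ℂ := ∏' n : ℕ, (1 - s * q ^ n)

section qProd

variable {q : ℂ}

theorem summable_norm_mul_pow (hq : ‖q‖ < 1) (s : ℂ) : Summable fun n : ℕ => ‖-(s * q ^ n)‖ := by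
  simpa using (summable_geometric_of_lt_one (norm_nonneg q) hq).mul_left ‖s‖

theorem multipliable_one_sub_mul_pow (hq : ‖q‖ < 1) (s : ℂ) :
    Multipliable fun n : ℕ => 1 - s * q ^ n := by
  simpa only [sub_eq_add_neg] using multipliable_one_add_of_summable (summable_norm_mul_pow hq s)

theorem qProd_eq (hq : ‖q‖ < 1) (s : ℂ) : qProd q s = (1 - s) * qProd q (q * s) := by
  have e : ∀ n : ℕ, 1 - s * q ^ (n + 1) = 1 - q * s * q ^ n := fun n => by ring
  have := tprod_eq_zero_mul' (f := fun n : ℕ => 1 - s * q ^ n)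
    ((multipliable_one_sub_mul_pow hq (q * s)).congr fun n => (e n).symm)
  simp only [e, pow_zero, mul_one] at this
  exact this

theorem qProd_ne_zero (hq : ‖q‖ < 1) {s : ℂ} (hs : ∀ n : ℕ, 1 - s * q ^ n ≠ 0) :
    qProd q s ≠ 0 := by
  have := tprod_one_add_ne_zero_of_summable (f := fun n : ℕ => -(s * q ^ n))
    (fun n => by rw [← sub_eq_add_neg]; exact hs n) (summable_norm_mul_pow hq s)
  simpa only [qProd, sub_eq_add_neg] using this

end qProd

section shift

variable {ρ : ℝ} {q : ℂ} {w : ℕ → ℂ} {g : ℂ}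

/-- As a function of s, Y(s) − Y(t) vanishes exactly at s = t and s = q/t; here s = g/q^n. -/
theorem param_factor (hρ : 0 < ρ) (h : IsMultiplier ρ q) (hg : g ≠ 0) {t : ℂ} (ht : t ≠ 0) (n : ℕ) :
    param ρ q (g / q ^ n) - param ρ q t =
      -(1 + ρ) * q / (ρ * (1 + q) * (1 - q) ^ 2) * (g / q ^ n) *
        ((1 - t / g * q ^ n) * (1 - q / (g * t) * q ^ n)) := by
  have h0 : (ρ : ℂ) ≠ 0 := by exact_mod_cast hρ.ne'
  have h1 := h.one_sub_ne_zero
  have h2 := h.one_add_ne_zero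
  have h3 := h.ne_zero
  simp only [param]
  field_simp
  ring

/-- The product over a half-chain in terms of the parametrization. -/
theorem zeroProd_param (hρ : 0 < ρ) (h : IsMultiplier ρ q) (hg : g ≠ 0)
    (hwg : ∀ n, w n = param ρ q (g / q ^ n)) (h0 : ∀ n, w n ≠ 0)
    (hw : Summable fun n => ‖(w n)⁻¹‖) {t : ℂ} (ht : t ≠ 0) :
    zeroProd w (param ρ q t) * (qProd q (1 / g) * qProd q (q / g)) =
      qProd q (t / g) * qProd q (q / (g * t)) := by
  have hq := h.norm_lt_one
  rw [zeroProd, qProd, qProd, qProd, qProd,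
    ← (multipliable_one_sub_mul_pow hq _).tprod_mul (multipliable_one_sub_mul_pow hq _),
    ← (multipliable_one_sub_mul_pow hq _).tprod_mul (multipliable_one_sub_mul_pow hq _),
    ← (multipliable_one_sub_div hw _).tprod_mul
      ((multipliable_one_sub_mul_pow hq _).mul (multipliable_one_sub_mul_pow hq _))]
  refine tprod_congr fun n => ?_
  have e1 := param_factor hρ h hg one_ne_zero n
  have e2 := param_factor hρ h hg ht n
  -- Since Y(1) = 0, the factorization at t = 1 is that of `w n` itself, and dividing by it
  -- normalizes each factor of the product.
  have hz : param ρ q 1 = 0 := by simp [param]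
  rw [hz, sub_zero, mul_one, ← hwg] at e1
  rw [← hwg] at e2
  set K := -(1 + (ρ : ℂ)) * q / (ρ * (1 + q) * (1 - q) ^ 2) * (g / q ^ n)
  have hK : K ≠ 0 := fun hK => h0 n (by rw [e1, hK, zero_mul])
  have e3 : 1 - param ρ q t / w n = (w n - param ρ q t) / w n := by
    rw [sub_div, div_self (h0 n)]
  rw [e3, e2, div_mul_eq_mul_div, div_eq_iff (h0 n), e1]
  ring

/-- Replacing t by t/q adds the factor 1 − t/(qg) to one Pochhammer product and removes 1 − q/(gt)
from the other. The normalizing constant is nonzero because no `w n` vanishes. -/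
theorem zeroProd_shift (hρ : 0 < ρ) (h : IsMultiplier ρ q) (hg : g ≠ 0)
    (hwg : ∀ n, w n = param ρ q (g / q ^ n)) (h0 : ∀ n, w n ≠ 0)
    (hw : Summable fun n => ‖(w n)⁻¹‖) {t : ℂ} (ht : t ≠ 0) :
    zeroProd w (param ρ q (t / q)) * (1 - q / (g * t)) =
      (1 - t / (q * g)) * zeroProd w (param ρ q t) := by
  have h3 := h.ne_zero
  have hq := h.norm_lt_one
  have e : ∀ n, (1 - 1 / g * q ^ n ≠ 0) ∧ (1 - q / g * q ^ n ≠ 0) := fun n => by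
    have e1 := param_factor hρ h hg one_ne_zero n
    have hz : param ρ q 1 = 0 := by simp [param]
    rw [hz, sub_zero, mul_one, ← hwg] at e1
    have := h0 n
    rw [e1] at this
    exact mul_ne_zero_iff.1 (mul_ne_zero_iff.1 this).2
  have hM : qProd q (1 / g) * qProd q (q / g) ≠ 0 :=
    mul_ne_zero (qProd_ne_zero hq fun n => (e n).1) (qProd_ne_zero hq fun n => (e n).2)
  apply mul_right_cancel₀ hM
  have E1 := zeroProd_param hρ h hg hwg h0 hw ht
  have E2 := zeroProd_param hρ h hg hwg h0 hw (div_ne_zero ht h3)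
  have F1 := qProd_eq hq (t / q / g)
  have F2 := qProd_eq hq (q / (g * t))
  rw [show q * (t / q / g) = t / g by field_simp, show t / q / g = t / (q * g) by field_simp] at F1
  rw [show t / q / g = t / (q * g) by field_simp,
    show q / (g * (t / q)) = q * (q / (g * t)) by field_simp, F1] at E2
  rw [F2] at E1
  linear_combination (1 - q / (g * t)) * E2 - (1 - t / (q * g)) * E1

/-- The functional equation of the quotient of the two canonical products. -/
theorem zeroProd_functional_equation (hρ : 0 < ρ) {a b : ℕ → ℂ} (ha : IsRecurrent ρ a)
    (hb : IsRecurrent ρ b) (ha0 : a 0 = 0) (ha1 : a 1 = -(1 + (ρ : ℂ)) / ρ)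
    (hbc : (b 0, b 1) ∈ curve ρ) (han : ∀ n, a (n + 1) ≠ 0) (hbn : ∀ n, b (n + 1) ≠ 0)
    (has : Summable fun n => ‖(a (n + 1))⁻¹‖) (hbs : Summable fun n => ‖(b (n + 1))⁻¹‖)
    {y z : ℂ} (hyz : (y, z) ∈ curve ρ) :
    zeroProd (fun n => a (n + 1)) y * zeroProd (fun n => b (n + 1)) z *
        (y * (b 1 * z - b 0 * y)) =
      zeroProd (fun n => a (n + 1)) z * zeroProd (fun n => b (n + 1)) y *
        (z * (b 1 * y - b 0 * z)) := by
  have hρ' : (ρ : ℂ) ≠ 0 := by exact_mod_cast hρ.ne'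
  obtain ⟨q, h⟩ := exists_isMultiplier hρ
  have h1 := h.one_sub_ne_zero
  have h2 := h.one_add_ne_zero
  have h3 := h.ne_zero
  obtain ⟨t, ht, rfl, rfl⟩ := h.exists_param hρ hyz
  obtain ⟨τ, hτ, hτ0, hτ1⟩ := h.exists_param hρ hbc
  have pa := ha.eq_param hρ h one_ne_zero (by simp [ha0, param]) (by
    rw [ha1, param]
    field_simp
    ring)
  have pb := hb.eq_param hρ h hτ hτ0.symm hτ1.symm
  -- The products start at index 1 of the chains, hence g = 1/q (from the parameter 1 of `a 0`) and
  -- g = τ/q.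
  have sa := zeroProd_shift hρ h (w := fun n => a (n + 1)) (g := 1 / q)
    (div_ne_zero one_ne_zero h3) (fun n => by rw [pa, pow_succ', div_div]) han has ht
  have sb := zeroProd_shift hρ h (w := fun n => b (n + 1)) (g := τ / q)
    (div_ne_zero hτ h3) (fun n => by rw [pb, pow_succ', div_div]) hbn hbs ht
  -- Both expressions share a double zero at t = q, absorbed in k. The remaining zeros are t = 1
  -- (from y) and t = q²/τ in the first, t = q² (from z) and t = τ in the second: precisely the
  -- shift factors of the two products.
  obtain ⟨k, k1, k2⟩ : ∃ k, param ρ q t * (b 1 * param ρ q (t / q) - b 0 * param ρ q t) =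
        k * ((1 - t / (q * (1 / q))) * (1 - q / (τ / q * t))) ∧
      param ρ q (t / q) * (b 1 * param ρ q t - b 0 * param ρ q (t / q)) =
        k * ((1 - q / (1 / q * t)) * (1 - t / (q * (τ / q)))) := by
    refine ⟨-(-(1 + ρ) * q / (ρ * (1 + q) * (1 - q) ^ 2)) ^ 3 * (τ / q - 1) * (1 / q - q) * t *
      (1 - q / t) ^ 2, ?_, ?_⟩ <;>
    · rw [← hτ0, ← hτ1]
      simp only [param]
      field_simp
      ring
  rw [k1, k2]
  linear_combination k * (zeroProd (fun n => a (n + 1)) (param ρ q t) *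
    (1 - t / (q * (1 / q)))) * sb - k * ((1 - t / (q * (τ / q))) *
      zeroProd (fun n => b (n + 1)) (param ρ q t)) * sa

end shift

/-! ### A boundary value problem on an ellipse -/

/-- For y = a + ib this reads (1+ρ²)a² + (1+ρ)²b² = (1+ρ)a, an ellipse through 0. -/
theorem pair_conj_mem_curve_iff {ρ : ℝ} (hρ : 0 < ρ) (y : ℂ) :
    (y, starRingEnd ℂ y) ∈ curve ρ ↔
      (1 + ρ) ^ 2 * Complex.normSq y = y.re * (1 + ρ + 2 * ρ * y.re) := by
  rw [mem_curve_iff hρ, Complex.mul_conj, Complex.add_conj]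
  constructor
  · intro h
    have : 2 * (1 + ρ) ^ 2 * Complex.normSq y = 2 * y.re * (1 + ρ + ρ * (2 * y.re)) := by
      exact_mod_cast h
    linarith
  · intro h
    have : 2 * (1 + ρ) ^ 2 * Complex.normSq y = 2 * y.re * (1 + ρ + ρ * (2 * y.re)) := by
      linarith
    exact_mod_cast this

/-- The bounds on Re y put x = Re y/(1+ρ) in [0, 1]; the norm bound comes from |y|² ≤ 1 + 2ρ <
(1+ρ)². -/
theorem bounds_of_mem_ellipse {ρ : ℝ} (hρ : 0 < ρ) {y : ℂ}
    (h : (1 + ρ) ^ 2 * Complex.normSq y ≤ y.re * (1 + ρ + 2 * ρ * y.re)) :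
    0 ≤ y.re ∧ y.re ≤ 1 + ρ ∧ ‖y‖ < 1 + ρ := by
  have hn : y.re ^ 2 ≤ Complex.normSq y := by
    rw [Complex.normSq_apply]; nlinarith [mul_self_nonneg y.im]
  have h1 : (1 + ρ ^ 2) * y.re ^ 2 ≤ (1 + ρ) * y.re := by
    nlinarith [mul_le_mul_of_nonneg_left hn (sq_nonneg (1 + ρ))]
  have h0 : 0 ≤ y.re := by
    have : 0 ≤ (1 + ρ) * y.re := le_trans (by positivity) h1
    exact nonneg_of_mul_nonneg_right this (by positivity)
  have h2 : y.re ≤ 1 + ρ := by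
    by_contra! hlt
    have : (1 + ρ) * y.re < y.re ^ 2 := by nlinarith
    nlinarith [mul_nonneg (sq_nonneg ρ) (sq_nonneg y.re)]
  refine ⟨h0, h2, ?_⟩
  have h3 : Complex.normSq y ≤ 1 + 2 * ρ := by
    have : (1 + ρ) ^ 2 * Complex.normSq y ≤ (1 + ρ) ^ 2 * (1 + 2 * ρ) := by
      refine h.trans ?_
      have : y.re * (1 + ρ + 2 * ρ * y.re) ≤ (1 + ρ) * (1 + ρ + 2 * ρ * (1 + ρ)) := by gcongr
      linarith
    exact le_of_mul_le_mul_left this (by positivity)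
  rw [Complex.normSq_eq_norm_sq] at h3
  apply lt_of_pow_lt_pow_left₀ 2 (by positivity)
  nlinarith

/-- The function exp(−isH) has modulus exp(s Im H), equal to 1 on the ellipse. The maximum principle
for s = ±1 gives Im H = 0 inside, and the open mapping theorem then makes H constant on the whole
disc. -/
theorem eq_const_of_real_on_ellipse {ρ : ℝ} (hρ : 0 < ρ) (hρ1 : ρ < 1) {H : ℂ → ℂ}
    (hH : DifferentiableOn ℂ H (Metric.ball 0 (1 + ρ)))
    (hr : ∀ y, (y, starRingEnd ℂ y) ∈ curve ρ → ‖y‖ < 1 + ρ → 0 ≤ y.re → y.re ≤ 1 + ρ →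
      (H y).im = 0) :
    ∃ C, ∀ y ∈ Metric.ball (0 : ℂ) (1 + ρ), H y = C := by
  set f : ℂ → ℝ := fun y => (1 + ρ) ^ 2 * Complex.normSq y
  set g : ℂ → ℝ := fun y => y.re * (1 + ρ + 2 * ρ * y.re)
  have hf : Continuous f := continuous_const.mul Complex.continuous_normSq
  have hg : Continuous g := by fun_prop
  set U : Set ℂ := {y | f y < g y}
  have hUo : IsOpen U := isOpen_lt hf hg
  have hcl : closure U ⊆ Metric.ball 0 (1 + ρ) := fun y hy =>
    mem_ball_zero_iff.2 (bounds_of_mem_ellipse hρ (closure_lt_subset_le hf hg hy)).2.2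
  have hUb : Bornology.IsBounded U := Metric.isBounded_ball.subset (subset_closure.trans hcl)
  have hne : U.Nonempty := by
    refine ⟨1 / 2, ?_⟩
    have e : ((1 : ℂ) / 2).re = 1 / 2 := by norm_num
    have e' : Complex.normSq ((1 : ℂ) / 2) = 1 / 4 := by norm_num
    simp only [U, f, g, Set.mem_ofPred_eq, e, e']
    nlinarith
  have hfr : ∀ y ∈ frontier U, (H y).im = 0 := by
    intro y hy
    have he : f y = g y := frontier_lt_subset_eq hf hg hy
    obtain ⟨h0, h1, h2⟩ := bounds_of_mem_ellipse hρ he.le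
    exact hr y ((pair_conj_mem_curve_iff hρ y).2 he) h2 h0 h1
  have hbound : ∀ s : ℝ, ∀ y ∈ U, s * (H y).im ≤ 0 := by
    intro s y hy
    have hd : DiffContOnCl ℂ (fun y => Complex.exp (-(s * Complex.I * H y))) U :=
      (((hH.mono hcl).const_mul _).neg.cexp).diffContOnCl
    have hn : ∀ y, ‖Complex.exp (-(s * Complex.I * H y))‖ = Real.exp (s * (H y).im) := fun y => by
      rw [Complex.norm_exp]
      congr 1
      simp
    have := Complex.norm_le_of_forall_mem_frontier_norm_le hUb hd (C := 1)
      (fun z hz => by rw [hn, hfr z hz, mul_zero, Real.exp_zero]) (subset_closure hy)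
    rw [hn, Real.exp_le_one_iff] at this
    exact this
  have him : ∀ y ∈ U, (H y).im = 0 := fun y hy =>
    le_antisymm (by simpa using hbound 1 y hy) (by simpa using hbound (-1) y hy)
  have hH' : AnalyticOnNhd ℂ H (Metric.ball 0 (1 + ρ)) := hH.analyticOnNhd Metric.isOpen_ball
  rcases hH'.is_constant_or_isOpen (convex_ball 0 (1 + ρ)).isPreconnected with h | h
  · exact h
  · exfalso
    have ho := Complex.isOpenMap_im _ (h U (subset_closure.trans hcl) hUo)
    have he : Complex.im '' (H '' U) = {0} := by
      rw [← Set.image_comp]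
      exact (Set.image_congr him).trans (hne.image_const 0)
    rw [he] at ho
    exact not_isOpen_singleton (0 : ℝ) ho

/-- The relation says that A/B equals its own conjugate on the ellipse. At real points this is
automatic, so only nonreal points need a hypothesis. -/
theorem eq_const_mul_of_ellipse {ρ : ℝ} (hρ : 0 < ρ) (hρ1 : ρ < 1) {A B : ℂ → ℂ}
    (hA : DifferentiableOn ℂ A (Metric.ball 0 (1 + ρ)))
    (hB : DifferentiableOn ℂ B (Metric.ball 0 (1 + ρ)))
    (hB0 : ∀ y ∈ Metric.ball (0 : ℂ) (1 + ρ), B y ≠ 0)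
    (hAc : ∀ y ∈ Metric.ball (0 : ℂ) (1 + ρ), A (starRingEnd ℂ y) = starRingEnd ℂ (A y))
    (hBc : ∀ y ∈ Metric.ball (0 : ℂ) (1 + ρ), B (starRingEnd ℂ y) = starRingEnd ℂ (B y))
    (hAB : ∀ y, (y, starRingEnd ℂ y) ∈ curve ρ → ‖y‖ < 1 + ρ → 0 ≤ y.re → y.re ≤ 1 + ρ →
      y.im ≠ 0 → A y * B (starRingEnd ℂ y) = A (starRingEnd ℂ y) * B y) :
    ∃ C, ∀ y ∈ Metric.ball (0 : ℂ) (1 + ρ), A y = C * B y := by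
  obtain ⟨C, hC⟩ := eq_const_of_real_on_ellipse hρ hρ1 (H := fun y => A y / B y)
    (hA.div hB hB0) (fun y hy hn h0 h1 => by
      have hy' : y ∈ Metric.ball (0 : ℂ) (1 + ρ) := mem_ball_zero_iff.2 hn
      have hb := hB0 y hy'
      rw [← Complex.conj_eq_iff_im, map_div₀, ← hAc y hy', ← hBc y hy']
      by_cases him : y.im = 0
      · rw [Complex.conj_eq_iff_im.2 him]
      · have hb' : B (starRingEnd ℂ y) ≠ 0 := by rw [hBc y hy']; simpa using hb
        rw [div_eq_div_iff hb' hb]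
        exact (hAB y hy hn h0 h1 him).symm)
  exact ⟨C, fun y hy => by rw [← hC y hy, div_mul_cancel₀ _ (hB0 y hy)]⟩

/-- If a power series agrees near `0` with a function holomorphic on a ball, then it converges to
that function on the whole ball. -/
theorem hasSum_of_eqOn_ball {a : ℕ → ℂ} {F : ℂ → ℂ} {r R : ℝ} (hr : 0 < r)
    (hF : DifferentiableOn ℂ F (Metric.ball 0 R))
    (ha : ∀ y ∈ Metric.ball (0 : ℂ) r, HasSum (fun n => a n * y ^ n) (F y)) {y : ℂ}
    (hy : y ∈ Metric.ball (0 : ℂ) R) : HasSum (fun n => a n * y ^ n) (F y) := by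
  have hT : ∀ z ∈ Metric.ball (0 : ℂ) R,
      HasSum (fun n : ℕ => z ^ n • ((n.factorial : ℂ)⁻¹ * iteratedDeriv n F 0)) (F z) := by
    intro z hz
    have e : (fun n : ℕ => z ^ n • ((n.factorial : ℂ)⁻¹ * iteratedDeriv n F 0)) =
        fun n : ℕ => (n.factorial : ℂ)⁻¹ • (z - 0) ^ n • iteratedDeriv n F 0 := by
      funext n
      simp only [sub_zero, smul_eq_mul]
      ring
    rw [e]
    exact Complex.hasSum_taylorSeries_on_ball hF hz
  have hR : 0 < R := Metric.pos_of_mem_ball hy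
  have p1 : HasFPowerSeriesAt F (FormalMultilinearSeries.ofScalars ℂ a) 0 := by
    rw [hasFPowerSeriesAt_iff]
    filter_upwards [Metric.ball_mem_nhds (0 : ℂ) hr] with z hz
    simpa [FormalMultilinearSeries.coeff_ofScalars, mul_comm] using ha z hz
  have p2 : HasFPowerSeriesAt F (FormalMultilinearSeries.ofScalars ℂ
      fun n : ℕ => (n.factorial : ℂ)⁻¹ * iteratedDeriv n F 0) 0 := by
    rw [hasFPowerSeriesAt_iff]
    filter_upwards [Metric.ball_mem_nhds (0 : ℂ) hR] with z hz
    simpa [FormalMultilinearSeries.coeff_ofScalars] using hT z hz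
  have e : a = fun n : ℕ => (n.factorial : ℂ)⁻¹ * iteratedDeriv n F 0 := by
    funext n
    have := congrArg (fun p => FormalMultilinearSeries.coeff p n)
      (p1.eq_formalMultilinearSeries p2)
    simpa [FormalMultilinearSeries.coeff_ofScalars] using this
  rw [e]
  convert hT y hy using 2 with n
  rw [smul_eq_mul, mul_comm]

/-! ### Scalar balance equations and symmetry -/

/-- Rate of arrivals at a queue of length `i` when the other queue has length `j`. -/
noncomputable def arrivalRate (ρ : ℝ) (i j : ℕ) : ℝ :=
  if i < j then 2 * ρ else if i = j then ρ else 0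

theorem arrivalRate_nonneg {ρ : ℝ} (hρ : 0 < ρ) (i j : ℕ) : 0 ≤ arrivalRate ρ i j := by
  unfold arrivalRate
  split_ifs <;> positivity

theorem arrivalRate_le {ρ : ℝ} (hρ : 0 < ρ) (i j : ℕ) : arrivalRate ρ i j ≤ 2 * ρ := by
  unfold arrivalRate
  split_ifs <;> linarith

theorem arrivalRate_add (ρ : ℝ) (i j : ℕ) : arrivalRate ρ i j + arrivalRate ρ j i = 2 * ρ := by
  unfold arrivalRate
  rcases lt_trichotomy i j with h | h | h
  · simp [h, h.not_gt, h.ne']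
  · simp [h]; ring
  · simp [h, h.not_gt, h.ne']

/-- The flow created by arrivals at the first queue. -/
noncomputable def arrivalFlow (ρ : ℝ) (f : ℕ × ℕ → ℝ) : ℕ × ℕ → ℝ
  | (0, _) => 0
  | (i + 1, j) => arrivalRate ρ i j * f (i, j)

/-- The total flow into a state. -/
noncomputable def inflow (ρ : ℝ) (f : ℕ × ℕ → ℝ) (w : ℕ × ℕ) : ℝ :=
  arrivalFlow ρ f w + arrivalFlow ρ (f ∘ Prod.swap) w.swap + f (w.1 + 1, w.2) + f (w.1, w.2 + 1)

/-- The total rate out of a state. -/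
noncomputable def outRate (ρ : ℝ) (w : ℕ × ℕ) : ℝ :=
  2 * ρ + (if 0 < w.1 then 1 else 0) + (if 0 < w.2 then 1 else 0)

theorem outRate_nonneg {ρ : ℝ} (hρ : 0 < ρ) (w : ℕ × ℕ) : 0 ≤ outRate ρ w := by
  unfold outRate
  split_ifs <;> positivity

theorem hasSum_arrival (ρ : ℝ) (f : ℕ × ℕ → ℝ) (w : ℕ × ℕ) :
    HasSum (fun v : ℕ × ℕ => f v * (if w = (v.1 + 1, v.2) then arrivalRate ρ v.1 v.2 else 0))
      (arrivalFlow ρ f w) := by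
  rcases w with ⟨_ | i, j⟩
  · simp [arrivalFlow, hasSum_zero]
  · convert hasSum_single (i, j) (fun v hv => ?_) using 1
    · simp [arrivalFlow, mul_comm]
    · rw [if_neg, mul_zero]
      rintro h
      simp only [Prod.mk.injEq, add_left_inj] at h
      exact hv (Prod.ext h.1.symm h.2.symm)

theorem IsInvariantDistribution.inflow_eq {ρ : ℝ} {π : ℕ × ℕ → ℝ}
    (h : IsInvariantDistribution ρ π) (w : ℕ × ℕ) : inflow ρ π w = outRate ρ w * π w := by
  have h1 := hasSum_arrival ρ π w
  have h2 : HasSum (fun v : ℕ × ℕ => π v *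
      (if w = (v.1, v.2 + 1) then arrivalRate ρ v.2 v.1 else 0))
      (arrivalFlow ρ (π ∘ Prod.swap) w.swap) := by
    have := hasSum_arrival ρ (π ∘ Prod.swap) w.swap
    rw [← (Equiv.prodComm ℕ ℕ).hasSum_iff] at this
    convert this using 2 with v
    rcases v with ⟨i, j⟩
    rcases w with ⟨k, l⟩
    simp [and_comm]
  have h3 : HasSum (fun v : ℕ × ℕ => π v * (if v = (w.1 + 1, w.2) then 1 else 0))
      (π (w.1 + 1, w.2)) := by
    simpa using hasSum_single (f := fun v : ℕ × ℕ => π v *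
      (if v = (w.1 + 1, w.2) then 1 else 0)) (w.1 + 1, w.2) (fun v hv => by simp [hv])
  have h4 : HasSum (fun v : ℕ × ℕ => π v * (if v = (w.1, w.2 + 1) then 1 else 0))
      (π (w.1, w.2 + 1)) := by
    simpa using hasSum_single (f := fun v : ℕ × ℕ => π v *
      (if v = (w.1, w.2 + 1) then 1 else 0)) (w.1, w.2 + 1) (fun v hv => by simp [hv])
  have h5 : HasSum (fun v : ℕ × ℕ => π v * (if w = v then outRate ρ v else 0))
      (π w * outRate ρ w) := by
    simpa using hasSum_single (f := fun v : ℕ × ℕ => π v *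
      (if w = v then outRate ρ v else 0)) w (fun v hv => by simp [hv.symm])
  have hs := (((h1.add h2).add h3).add h4).sub h5
  have hb := h.balance w
  have := hs.unique (hb.congr_fun ?_)
  · unfold inflow
    linarith
  · intro v
    have e : (if v.1 = v.2 then ρ else 0) = (if v.2 = v.1 then ρ else 0) := by
      simp only [eq_comm]
    simp only [rateMatrix, arrivalRate, outRate, e]
    ring

section inflow

variable {ρ : ℝ}

theorem arrivalFlow_add (f g : ℕ × ℕ → ℝ) (w : ℕ × ℕ) :
    arrivalFlow ρ (fun v => f v + g v) w = arrivalFlow ρ f w + arrivalFlow ρ g w := by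
  rcases w with ⟨_ | i, j⟩ <;> simp [arrivalFlow, mul_add]

theorem inflow_add (f g : ℕ × ℕ → ℝ) (w : ℕ × ℕ) :
    inflow ρ (fun v => f v + g v) w = inflow ρ f w + inflow ρ g w := by
  have h1 := arrivalFlow_add (ρ := ρ) f g w
  have h2 := arrivalFlow_add (ρ := ρ) (f ∘ Prod.swap) (g ∘ Prod.swap) w.swap
  have e : (fun v => f v + g v) ∘ Prod.swap =
    fun v => (f ∘ Prod.swap) v + (g ∘ Prod.swap) v := rfl
  simp only [inflow, e, h1, h2]
  ring

theorem abs_arrivalFlow_le (hρ : 0 < ρ) (f : ℕ × ℕ → ℝ) (w : ℕ × ℕ) :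
    |arrivalFlow ρ f w| ≤ arrivalFlow ρ (fun v => |f v|) w := by
  rcases w with ⟨_ | i, j⟩
  · simp [arrivalFlow]
  · simp [arrivalFlow, abs_mul, abs_of_nonneg (arrivalRate_nonneg hρ i j)]

theorem abs_inflow_le (hρ : 0 < ρ) (f : ℕ × ℕ → ℝ) (w : ℕ × ℕ) :
    |inflow ρ f w| ≤ inflow ρ (fun v => |f v|) w := by
  have h1 := abs_arrivalFlow_le hρ f w
  have h2 := abs_arrivalFlow_le hρ (f ∘ Prod.swap) w.swap
  unfold inflow
  refine (abs_add_le _ _).trans (add_le_add ((abs_add_le _ _).trans (add_le_add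
    ((abs_add_le _ _).trans (add_le_add h1 h2)) le_rfl)) le_rfl)

theorem inflow_swap (f : ℕ × ℕ → ℝ) (w : ℕ × ℕ) :
    inflow ρ (f ∘ Prod.swap) w = inflow ρ f w.swap := by
  have e : (f ∘ Prod.swap) ∘ Prod.swap = f := by ext; simp
  simp only [inflow, e, Prod.swap_swap]
  simp only [Function.comp, Prod.swap_prod_mk, Prod.fst_swap, Prod.snd_swap]
  ring

theorem arrivalFlow_nonneg (hρ : 0 < ρ) {f : ℕ × ℕ → ℝ} (hf : ∀ v, 0 ≤ f v) (w : ℕ × ℕ) :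
    0 ≤ arrivalFlow ρ f w := by
  rcases w with ⟨_ | i, j⟩
  · simp [arrivalFlow]
  · exact mul_nonneg (arrivalRate_nonneg hρ i j) (hf _)

/-- Where f vanishes its inflow is zero, so f also vanishes at the states leading there by a
departure; from the origin this reaches every state. -/
theorem eq_zero_of_inflow_eq (hρ : 0 < ρ) {f : ℕ × ℕ → ℝ} (hf : ∀ v, 0 ≤ f v)
    (hb : ∀ w, inflow ρ f w = outRate ρ w * f w) (h0 : f (0, 0) = 0) (w : ℕ × ℕ) : f w = 0 := by
  have step : ∀ v, f v = 0 → f (v.1 + 1, v.2) = 0 ∧ f (v.1, v.2 + 1) = 0 := by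
    intro v hv
    have := hb v
    rw [hv, mul_zero, inflow] at this
    have h1 := arrivalFlow_nonneg hρ hf v
    have h2 := arrivalFlow_nonneg hρ (f := f ∘ Prod.swap) (fun v => hf _) v.swap
    have h3 := hf (v.1 + 1, v.2)
    have h4 := hf (v.1, v.2 + 1)
    constructor <;> linarith
  have h1 : ∀ i, f (i, 0) = 0 := fun i => by
    induction i with
    | zero => exact h0
    | succ k ih => exact (step _ ih).1
  obtain ⟨i, j⟩ := w
  induction j with
  | zero => exact h1 i
  | succ k ih => exact (step _ ih).2

theorem summable_bdd_mul {c : ℕ × ℕ → ℝ} {f : ℕ × ℕ → ℝ} {M : ℝ} (hc0 : ∀ v, 0 ≤ c v)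
    (hc : ∀ v, c v ≤ M) (hf : Summable f) : Summable fun v => c v * f v :=
  Summable.of_norm_bounded (hf.abs.mul_left M) fun v => by
    rw [Real.norm_eq_abs, abs_mul, abs_of_nonneg (hc0 v)]
    exact mul_le_mul_of_nonneg_right (hc v) (abs_nonneg _)

theorem hasSum_shift_fst {g : ℕ × ℕ → ℝ} {S : ℝ} (h0 : ∀ j, g (0, j) = 0) :
    HasSum (fun v : ℕ × ℕ => g (v.1 + 1, v.2)) S ↔ HasSum g S := by
  have hi : Function.Injective fun v : ℕ × ℕ => (v.1 + 1, v.2) := by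
    rintro ⟨a, b⟩ ⟨c, d⟩ h
    simpa using h
  refine hi.hasSum_iff (f := g) ?_
  rintro ⟨_ | i, j⟩ h
  · exact h0 j
  · exact absurd ⟨(i, j), rfl⟩ h

theorem hasSum_arrivalFlow (hρ : 0 < ρ) {f : ℕ × ℕ → ℝ} (hf : Summable f) :
    HasSum (arrivalFlow ρ f) (∑' v : ℕ × ℕ, arrivalRate ρ v.1 v.2 * f v) := by
  rw [← hasSum_shift_fst (fun j => rfl)]
  exact (summable_bdd_mul (fun v => arrivalRate_nonneg hρ v.1 v.2)
    (fun v => arrivalRate_le hρ v.1 v.2) hf).hasSum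

theorem hasSum_departure {f : ℕ × ℕ → ℝ} (hf : Summable f) :
    HasSum (fun v : ℕ × ℕ => f (v.1 + 1, v.2))
      (∑' v : ℕ × ℕ, (if 0 < v.1 then 1 else 0) * f v) := by
  have h := (summable_bdd_mul (c := fun v : ℕ × ℕ => if 0 < v.1 then 1 else 0) (M := 1)
    (fun v => by split_ifs <;> norm_num) (fun v => by split_ifs <;> norm_num) hf).hasSum
  rw [← hasSum_shift_fst (fun j => by simp)] at h
  simpa using h

/-- Conservation of the total mass. -/
theorem hasSum_inflow_sub (hρ : 0 < ρ) {f : ℕ × ℕ → ℝ} (hf : Summable f) :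
    HasSum (fun w => inflow ρ f w - outRate ρ w * f w) 0 := by
  have hfs : Summable (f ∘ Prod.swap) := (Equiv.prodComm ℕ ℕ).summable_iff.2 hf
  have h1 := hasSum_arrivalFlow hρ hf
  have h2 := (Equiv.prodComm ℕ ℕ).hasSum_iff.2 (hasSum_arrivalFlow hρ hfs)
  have h3 := hasSum_departure hf
  have h4 := (Equiv.prodComm ℕ ℕ).hasSum_iff.2 (hasSum_departure hfs)
  have k1 := (summable_bdd_mul (fun v => arrivalRate_nonneg hρ v.1 v.2)
    (fun v => arrivalRate_le hρ v.1 v.2) hf).hasSum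
  have k2 := (Equiv.prodComm ℕ ℕ).hasSum_iff.2
    (summable_bdd_mul (fun v => arrivalRate_nonneg hρ v.1 v.2)
    (fun v => arrivalRate_le hρ v.1 v.2) hfs).hasSum
  have k3 := (summable_bdd_mul (c := fun v : ℕ × ℕ => if 0 < v.1 then 1 else 0) (M := 1)
    (fun v => by split_ifs <;> norm_num) (fun v => by split_ifs <;> norm_num) hf).hasSum
  have k4 := (Equiv.prodComm ℕ ℕ).hasSum_iff.2
    (summable_bdd_mul (c := fun v : ℕ × ℕ => if 0 < v.1 then 1 else 0) (M := 1)
    (fun v => by split_ifs <;> norm_num) (fun v => by split_ifs <;> norm_num) hfs).hasSum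
  have := (((h1.add h2).add h3).add h4).sub (((k1.add k2).add k3).add k4)
  rw [sub_self] at this
  refine this.congr_fun fun w => ?_
  have e := arrivalRate_add ρ w.1 w.2
  simp only [inflow, outRate, Function.comp, Equiv.prodComm_apply, Prod.fst_swap, Prod.snd_swap,
    Prod.swap_swap, Prod.swap_prod_mk]
  by_cases h : 0 < w.2 <;> simp only [h, if_true, if_false] <;> linear_combination f w * e

end inflow

/-- The invariant distribution is symmetric. -/
theorem IsInvariantDistribution.symm {ρ : ℝ} (hρ : 0 < ρ) {π : ℕ × ℕ → ℝ}
    (h : IsInvariantDistribution ρ π) (w : ℕ × ℕ) : π w.swap = π w := by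
  set d : ℕ × ℕ → ℝ := fun v => π v + -(π ∘ Prod.swap) v
  have hneg : ∀ (f : ℕ × ℕ → ℝ) w, inflow ρ (fun v => -f v) w = -inflow ρ f w := by
    intro f w
    have e := inflow_add (ρ := ρ) f (fun v => -f v) w
    have z : inflow ρ (fun v => f v + -f v) w = 0 := by
      rcases w with ⟨_ | i, _ | j⟩ <;> simp [inflow, arrivalFlow]
    linarith
  have hd : ∀ w, inflow ρ d w = outRate ρ w * d w := by
    intro w
    have e : outRate ρ w.swap = outRate ρ w := by
      simp only [outRate, Prod.fst_swap, Prod.snd_swap]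
      ring
    rw [inflow_add, hneg, inflow_swap, h.inflow_eq, h.inflow_eq, e]
    simp only [d, Function.comp]
    ring
  have hds : Summable d :=
    h.hasSum_one.summable.add ((Equiv.prodComm ℕ ℕ).summable_iff.2 h.hasSum_one.summable).neg
  -- The defect inflow(|d|) − outRate·|d| is nonnegative by the triangle inequality and sums to 0 by
  -- conservation of mass, so |d| is balanced too.
  have habs : ∀ w, inflow ρ (fun v => |d v|) w = outRate ρ w * |d w| := by
    have hs := hasSum_inflow_sub hρ hds.abs
    have hnn : ∀ w, 0 ≤ inflow ρ (fun v => |d v|) w - outRate ρ w * |d w| := fun w => by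
      have := abs_inflow_le hρ d w
      rw [hd, abs_mul, abs_of_nonneg (outRate_nonneg hρ w)] at this
      linarith
    have := (hasSum_zero_iff_of_nonneg hnn).1 hs
    exact fun w => sub_eq_zero.1 (congrFun this w)
  -- The antisymmetric part d vanishes at the origin, so the nonnegative balanced function |d| + d
  -- is zero. Thus d ≤ 0 everywhere, and antisymmetry gives d = 0.
  have hz : ∀ w, |d w| + d w = 0 := eq_zero_of_inflow_eq hρ (f := fun v => |d v| + d v)
    (fun v => by linarith [neg_abs_le (d v)])
    (fun w => by rw [inflow_add, habs, hd]; ring) (by simp [d])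
  have hle : ∀ w, d w ≤ 0 := fun w => by linarith [hz w, abs_nonneg (d w)]
  have h1 := hle w
  have h2 := hle w.swap
  simp only [d, Function.comp, Prod.swap_swap] at h1 h2
  linarith

/-! ### The folded chain -/

/-- The weight at `n` of the arrivals from difference `n` to difference `n + 1`. -/
noncomputable def diagRate (ρ : ℝ) (n : ℕ) : ℝ := if n = 0 then ρ else 0

/-- Balance equations in terms of the shorter queue `m` and of the difference `n`;
`p m n` is the probability of the state `(m, m + n)`. -/
structure IsFolded (ρ : ℝ) (p : ℕ → ℕ → ℝ) : Prop where
  nonneg : ∀ m n, 0 ≤ p m n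
  summable : Summable fun v : ℕ × ℕ => p v.1 v.2
  zero_zero : ρ * p 0 0 = p 0 1
  succ_zero : ∀ m, (ρ + 1) * p (m + 1) 0 = 2 * ρ * p m 1 + p (m + 1) 1
  zero_succ : ∀ n, (2 * ρ + 1) * p 0 (n + 1) = diagRate ρ n * p 0 n + p 1 n + p 0 (n + 2)
  succ_succ : ∀ m n, (2 * ρ + 2) * p (m + 1) (n + 1) =
    2 * ρ * p m (n + 2) + diagRate ρ n * p (m + 1) n + p (m + 2) n + p (m + 1) (n + 2)
  -- Off-diagonal states count twice, once for each order of the queues.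
  total : ∑' v : ℕ × ℕ, p v.1 v.2 + ∑' v : ℕ × ℕ, p v.1 (v.2 + 1) = 1

/-- The longer queue gains a customer only from a tie, and then receives half of the arrivals. -/
theorem arrivalRate_add_right (ρ : ℝ) (m n : ℕ) : arrivalRate ρ (m + n) m = diagRate ρ n := by
  unfold arrivalRate diagRate
  rcases n with _ | n <;> simp

theorem injective_fold : Function.Injective fun v : ℕ × ℕ => (v.1, v.1 + v.2) := by
  rintro ⟨a, b⟩ ⟨c, d⟩ h
  simp only [Prod.mk.injEq] at h ⊢
  omega

theorem injective_fold_swap : Function.Injective fun v : ℕ × ℕ => (v.1 + v.2 + 1, v.1) := by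
  rintro ⟨a, b⟩ ⟨c, d⟩ h
  simp only [Prod.mk.injEq] at h ⊢
  omega

theorem IsInvariantDistribution.isFolded {ρ : ℝ} (hρ : 0 < ρ) {π : ℕ × ℕ → ℝ}
    (h : IsInvariantDistribution ρ π) : IsFolded ρ fun m n => π (m, m + n) := by
  have hs : ∀ i j, π (i, j) = π (j, i) := fun i j => h.symm hρ (j, i)
  have hb := h.inflow_eq
  have hsum : Summable fun v : ℕ × ℕ => π (v.1, v.1 + v.2) :=
    h.hasSum_one.summable.comp_injective injective_fold
  refine ⟨fun m n => h.nonneg _, hsum, ?_, fun m => ?_, fun n => ?_, fun m n => ?_, ?_⟩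
  · have := hb (0, 0)
    simp only [inflow, outRate, arrivalFlow, Prod.swap_prod_mk, hs 1 0] at this
    norm_num at this ⊢
    linarith
  · have := hb (m + 1, m + 1)
    simp only [inflow, outRate, arrivalFlow, Function.comp, Prod.swap_prod_mk, arrivalRate,
      hs (m + 1) m, hs (m + 1 + 1) (m + 1)] at this
    norm_num at this ⊢
    linarith
  · have := hb (0, n + 1)
    have e := arrivalRate_add_right ρ 0 n
    rw [zero_add] at e
    simp only [inflow, outRate, arrivalFlow, Function.comp, Prod.swap_prod_mk, e] at this
    norm_num at this ⊢
    rw [add_comm 1 n]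
    linarith
  · have := hb (m + 1, m + 1 + n + 1)
    have e := arrivalRate_add_right ρ (m + 1) n
    have e2 : arrivalRate ρ m (m + 1 + n + 1) = 2 * ρ := by
      rw [arrivalRate, if_pos (by omega)]
    simp only [inflow, outRate, arrivalFlow, Function.comp, Prod.swap_prod_mk, e, e2] at this
    norm_num at this ⊢
    rw [show m + (n + 2) = m + 1 + n + 1 by ring, show m + 2 + n = m + 1 + n + 1 by ring,
      show m + 1 + (n + 2) = m + 1 + n + 1 + 1 by ring,
      show m + 1 + (n + 1) = m + 1 + n + 1 by ring,
      show m + 2 = m + 1 + 1 by ring]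
    linarith
  · have k1 : HasSum (fun v : ℕ × ℕ => if v.1 ≤ v.2 then π v else 0)
        (∑' v : ℕ × ℕ, π (v.1, v.1 + v.2)) := by
      rw [← injective_fold.hasSum_iff]
      · simpa [Function.comp_def] using hsum.hasSum
      · rintro ⟨i, j⟩ hv
        rw [if_neg]
        exact fun hle => hv ⟨(i, j - i), by simp only [Prod.mk.injEq, true_and]; omega⟩
    have k2 : HasSum (fun v : ℕ × ℕ => if v.1 ≤ v.2 then 0 else π v)
        (∑' v : ℕ × ℕ, π (v.1, v.1 + (v.2 + 1))) := by
      rw [← injective_fold_swap.hasSum_iff]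
      · have e : ((fun v : ℕ × ℕ => if v.1 ≤ v.2 then 0 else π v) ∘
            fun v : ℕ × ℕ => (v.1 + v.2 + 1, v.1)) = fun v => π (v.1, v.1 + (v.2 + 1)) := by
          funext v
          simp only [Function.comp]
          rw [if_neg (by omega), hs]
          rfl
        rw [e]
        have hi : Function.Injective fun v : ℕ × ℕ => (v.1, v.2 + 1) := by
          rintro ⟨a, b⟩ ⟨c, d⟩ h
          simpa using h
        exact (hsum.comp_injective hi).hasSum
      · rintro ⟨i, j⟩ hv
        rw [if_pos]
        by_contra hle
        exact hv ⟨(j, i - j - 1), by simp only [Prod.mk.injEq, and_true]; omega⟩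
    refine (k1.add k2).unique (h.hasSum_one.congr_fun fun v => ?_)
    by_cases hv : v.1 ≤ v.2 <;> simp [hv]

namespace IsFolded

variable {ρ : ℝ} {p : ℕ → ℕ → ℝ}

/-- The generating function of a fixed difference. -/
noncomputable def rowSum (p : ℕ → ℕ → ℝ) (x : ℝ) (n : ℕ) : ℝ := ∑' m, p m n * x ^ m

theorem summable_fst (h : IsFolded ρ p) (n : ℕ) : Summable fun m => p m n :=
  h.summable.comp_injective (i := (·, n)) fun a b hab => by simpa using hab

theorem summable_snd (h : IsFolded ρ p) (m : ℕ) : Summable fun n => p m n :=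
  h.summable.comp_injective (i := fun n => (m, n)) fun a b hab => by simpa using hab

theorem summable_row (h : IsFolded ρ p) {x : ℝ} (hx0 : 0 ≤ x) (hx1 : x ≤ 1) (n : ℕ) :
    Summable fun m => p m n * x ^ m :=
  Summable.of_nonneg_of_le (fun _ => mul_nonneg (h.nonneg _ _) (pow_nonneg hx0 _))
    (fun _ => mul_le_of_le_one_right (h.nonneg _ _) (pow_le_one₀ hx0 hx1)) (h.summable_fst n)

theorem rowSum_nonneg (h : IsFolded ρ p) {x : ℝ} (hx0 : 0 ≤ x) (n : ℕ) : 0 ≤ rowSum p x n :=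
  tsum_nonneg fun _ => mul_nonneg (h.nonneg _ _) (pow_nonneg hx0 _)

theorem rowSum_le (h : IsFolded ρ p) {x : ℝ} (hx0 : 0 ≤ x) (hx1 : x ≤ 1) (n : ℕ) :
    rowSum p x n ≤ rowSum p 1 n :=
  (h.summable_row hx0 hx1 n).tsum_le_tsum (fun m => by
    rw [one_pow, mul_one]
    exact mul_le_of_le_one_right (h.nonneg _ _) (pow_le_one₀ hx0 hx1))
    (h.summable_row zero_le_one le_rfl n)

theorem rowSum_one_eq (p : ℕ → ℕ → ℝ) (n : ℕ) : rowSum p 1 n = ∑' m, p m n := by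
  simp [rowSum]

theorem le_rowSum_one (h : IsFolded ρ p) (m n : ℕ) : p m n ≤ rowSum p 1 n := by
  rw [rowSum_one_eq]
  exact (h.summable_fst n).le_tsum m fun m _ => h.nonneg m n

/-- Row recurrence of the generating functions on the boundary. -/
theorem rowSum_zero (h : IsFolded ρ p) {x : ℝ} (hx0 : 0 ≤ x) (hx1 : x ≤ 1) :
    (1 + 2 * ρ * x) * rowSum p x 1 = (1 + ρ) * rowSum p x 0 - p 0 0 := by
  have hs := h.summable_row hx0 hx1
  have hs' : ∀ n, Summable fun m => p (m + 1) n * x ^ (m + 1) := fun n =>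
    (summable_nat_add_iff 1).2 (hs n)
  have s0 : ∀ n, rowSum p x n = p 0 n + ∑' m, p (m + 1) n * x ^ (m + 1) := fun n => by
    rw [rowSum, (hs n).tsum_eq_zero_add, pow_zero, mul_one]
  have e : (ρ + 1) * ∑' m, p (m + 1) 0 * x ^ (m + 1) =
      2 * ρ * x * rowSum p x 1 + ∑' m, p (m + 1) 1 * x ^ (m + 1) := by
    rw [rowSum, ← tsum_mul_left, ← tsum_mul_left, ← ((hs 1).mul_left _).tsum_add (hs' 1)]
    refine tsum_congr fun m => ?_
    linear_combination x ^ (m + 1) * h.succ_zero m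
  linear_combination (-1 : ℝ) * e + s0 1 + (-(1 + ρ)) * s0 0 + (-1 : ℝ) * h.zero_zero

/-- Row recurrence of the generating functions in the interior. -/
theorem rowSum_succ (h : IsFolded ρ p) {x : ℝ} (hx0 : 0 ≤ x) (hx1 : x ≤ 1) (n : ℕ) :
    (2 * ρ + 2) * x * rowSum p x (n + 1) - x * p 0 (n + 1) =
      x * (1 + 2 * ρ * x) * rowSum p x (n + 2) + diagRate ρ n * x * rowSum p x n
        + rowSum p x n - p 0 n := by
  have hs := h.summable_row hx0 hx1
  have hs1 : ∀ n, Summable fun m => p (m + 1) n * x ^ (m + 1) := fun n =>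
    (summable_nat_add_iff 1).2 (hs n)
  have hs2 : ∀ n, Summable fun m => p (m + 2) n * x ^ (m + 2) := fun n =>
    (summable_nat_add_iff 2).2 (hs n)
  have s1 : ∀ n, rowSum p x n = p 0 n + ∑' m, p (m + 1) n * x ^ (m + 1) := fun n => by
    rw [rowSum, (hs n).tsum_eq_zero_add, pow_zero, mul_one]
  have s2 : ∑' m, p (m + 1) n * x ^ (m + 1) = p 1 n * x + ∑' m, p (m + 2) n * x ^ (m + 2) := by
    rw [(hs1 n).tsum_eq_zero_add, zero_add, pow_one]
  have e : (2 * ρ + 2) * x * ∑' m, p (m + 1) (n + 1) * x ^ (m + 1) =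
      2 * ρ * x ^ 2 * rowSum p x (n + 2) + diagRate ρ n * x * ∑' m, p (m + 1) n * x ^ (m + 1)
        + ∑' m, p (m + 2) n * x ^ (m + 2) + x * ∑' m, p (m + 1) (n + 2) * x ^ (m + 1) := by
    rw [rowSum, ← tsum_mul_left, ← tsum_mul_left, ← tsum_mul_left, ← tsum_mul_left,
      ← ((hs _).mul_left _).tsum_add ((hs1 n).mul_left _),
      ← (((hs _).mul_left _).add ((hs1 n).mul_left _)).tsum_add (hs2 n),
      ← ((((hs _).mul_left _).add ((hs1 n).mul_left _)).add (hs2 n)).tsum_add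
        ((hs1 _).mul_left _)]
    refine tsum_congr fun m => ?_
    linear_combination x ^ (m + 2) * h.succ_succ m n
  linear_combination e + (2 * ρ + 2) * x * s1 (n + 1) - (1 + diagRate ρ n * x) * s1 n - s2
    - x * s1 (n + 2) + x * h.zero_succ n

theorem hasSum_rowSum (h : IsFolded ρ p) :
    HasSum (rowSum p 1) (∑' v : ℕ × ℕ, p v.1 v.2) := by
  have hs := (Equiv.prodComm ℕ ℕ).hasSum_iff.2 h.summable.hasSum
  refine (hs.prod_fiberwise fun n => (h.summable_fst n).hasSum).congr_fun fun n => ?_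
  exact rowSum_one_eq p n

/-- Cut equation for the difference of the queue lengths. -/
theorem rowSum_cut (h : IsFolded ρ p) (n : ℕ) :
    (2 * ρ + 1) * rowSum p 1 (n + 2) = rowSum p 1 (n + 1) - p 0 (n + 1) := by
  -- The row recurrence at x = 1 says that J is constant in n; its terms tend to 0, so J = 0.
  set J : ℕ → ℝ := fun n => (2 * ρ + 1) * rowSum p 1 (n + 2) - rowSum p 1 (n + 1) + p 0 (n + 1)
    with hJ
  have hstep : ∀ n, J (n + 1) = J n := fun n => by
    have e := h.rowSum_succ zero_le_one le_rfl (n + 1)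
    rw [diagRate, if_neg (Nat.succ_ne_zero n)] at e
    simp only [hJ]
    linear_combination (-1 : ℝ) * e
  have hconst : ∀ n, J n = J 0 := fun n => by
    induction n with
    | zero => rfl
    | succ k ih => rw [hstep, ih]
  have hg := h.hasSum_rowSum.summable.tendsto_atTop_zero
  have ha := (h.summable_snd 0).tendsto_atTop_zero
  have hlim : Tendsto J atTop (𝓝 0) := by
    have := ((((tendsto_add_atTop_iff_nat 2).2 hg).const_mul (2 * ρ + 1)).sub
      ((tendsto_add_atTop_iff_nat 1).2 hg)).add ((tendsto_add_atTop_iff_nat 1).2 ha)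
    simpa using this
  have h0 : J 0 = 0 := by
    refine tendsto_nhds_unique (tendsto_const_nhds.congr fun n => ?_) hlim
    exact (hconst n).symm
  have := hconst n
  rw [h0] at this
  simp only [hJ] at this
  linarith

/-- Dropping p 0 (n+1) ≥ 0 from the cut equation gives decay with ratio 1/(1+2ρ). This carries the
series beyond the unit disc, far enough to contain the ellipse. -/
theorem rowSum_one_le (hρ : 0 < ρ) (h : IsFolded ρ p) (n : ℕ) :
    rowSum p 1 (n + 1) ≤ rowSum p 1 1 * ((1 + 2 * ρ)⁻¹) ^ n := by
  induction n with
  | zero => simp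
  | succ k ih =>
    have e := h.rowSum_cut k
    have hp := h.nonneg 0 (k + 1)
    have h1 : rowSum p 1 (k + 2) ≤ rowSum p 1 (k + 1) * (1 + 2 * ρ)⁻¹ := by
      rw [← div_eq_mul_inv, le_div_iff₀ (by positivity)]
      linarith
    refine h1.trans ?_
    rw [pow_succ, ← mul_assoc]
    exact mul_le_mul_of_nonneg_right ih (by positivity)

theorem summable_rowSum_mul_pow (hρ : 0 < ρ) (h : IsFolded ρ p) {r : ℝ} (hr0 : 0 ≤ r)
    (hr : r < 1 + 2 * ρ) : Summable fun n => rowSum p 1 n * r ^ n := by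
  rw [← summable_nat_add_iff 1]
  have hg : Summable fun n : ℕ => rowSum p 1 1 * r * ((1 + 2 * ρ)⁻¹ * r) ^ n := by
    refine (summable_geometric_of_lt_one (by positivity) ?_).mul_left _
    rw [inv_mul_lt_iff₀ (by positivity), mul_one]
    exact hr
  refine Summable.of_nonneg_of_le (fun n => mul_nonneg (h.rowSum_nonneg zero_le_one _)
    (pow_nonneg hr0 _)) (fun n => ?_) hg
  calc rowSum p 1 (n + 1) * r ^ (n + 1)
      ≤ rowSum p 1 1 * ((1 + 2 * ρ)⁻¹) ^ n * r ^ (n + 1) :=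
        mul_le_mul_of_nonneg_right (h.rowSum_one_le hρ n) (by positivity)
    _ = _ := by rw [mul_pow]; ring

theorem summable_norm_mul_pow (hρ : 0 < ρ) (h : IsFolded ρ p) {b : ℕ → ℝ}
    (hb : ∀ n, |b n| ≤ rowSum p 1 n) {y : ℂ} (hy : ‖y‖ < 1 + 2 * ρ) :
    Summable fun n => (b n : ℂ) * y ^ n :=
  Summable.of_norm_bounded (h.summable_rowSum_mul_pow hρ (norm_nonneg y) hy) fun n => by
    rw [norm_mul, norm_pow, Complex.norm_real]
    exact mul_le_mul_of_nonneg_right (hb n) (by positivity)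

theorem abs_boundary_le (h : IsFolded ρ p) (n : ℕ) : |p 0 n| ≤ rowSum p 1 n := by
  rw [abs_of_nonneg (h.nonneg _ _)]
  exact h.le_rowSum_one 0 n

theorem abs_rowSum_le (h : IsFolded ρ p) {x : ℝ} (hx0 : 0 ≤ x) (hx1 : x ≤ 1) (n : ℕ) :
    |rowSum p x n| ≤ rowSum p 1 n := by
  rw [abs_of_nonneg (h.rowSum_nonneg hx0 n)]
  exact h.rowSum_le hx0 hx1 n

/-- A power series with shifted coefficients. -/
theorem summable_and_shift {c : ℕ → ℂ} {y : ℂ} (hy : y ≠ 0) (hc : Summable fun n => c n * y ^ n) :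
    (Summable fun n => c (n + 1) * y ^ n) ∧
      ∑' n, c n * y ^ n = c 0 + y * ∑' n, c (n + 1) * y ^ n := by
  have h1 : Summable fun n => c (n + 1) * y ^ n := by
    have := ((summable_nat_add_iff 1).2 hc).mul_left y⁻¹
    refine this.congr fun n => ?_
    rw [pow_succ]
    field_simp
  refine ⟨h1, ?_⟩
  rw [hc.tsum_eq_zero_add, pow_zero, mul_one, ← tsum_mul_left]
  congr 1
  exact tsum_congr fun n => by ring

/-- The functional equation on the zero set of the kernel. -/
theorem kernel_equation (hρ : 0 < ρ) (h : IsFolded ρ p) {x : ℝ} (hx0 : 0 ≤ x) (hx1 : x ≤ 1)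
    {y : ℂ} (hy0 : y ≠ 0) (hy : ‖y‖ < 1 + 2 * ρ)
    (hk : y ^ 2 - 2 * (1 + ρ) * x * y + (1 + 2 * ρ * x) * x = 0) :
    (∑' n, (p 0 n : ℂ) * y ^ n) * (x - y) +
      rowSum p x 0 * (y + ρ * x * y - (1 + ρ) * x) = 0 := by
  have sa := h.summable_norm_mul_pow hρ h.abs_boundary_le hy
  have sf := h.summable_norm_mul_pow hρ (h.abs_rowSum_le hx0 hx1) hy
  obtain ⟨sa1, ea⟩ := summable_and_shift (c := fun n => (p 0 n : ℂ)) hy0 sa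
  obtain ⟨sf1, ef⟩ := summable_and_shift (c := fun n => (rowSum p x n : ℂ)) hy0 sf
  obtain ⟨sf2, ef1⟩ := summable_and_shift (c := fun n => (rowSum p x (n + 1) : ℂ)) hy0 sf1
  have e0 : (1 + 2 * ρ * x : ℂ) * rowSum p x 1 = (1 + ρ) * rowSum p x 0 - p 0 0 := by
    exact_mod_cast h.rowSum_zero hx0 hx1
  have hd : HasSum (fun n => (diagRate ρ n * x * rowSum p x n : ℂ) * y ^ n)
      (ρ * x * rowSum p x 0) := by
    convert hasSum_single 0 (fun n hn => ?_) using 1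
    · simp [diagRate]
    · simp [diagRate, hn]
  have hL := ((sf1.hasSum.mul_left ((2 * ρ + 2) * x : ℂ)).sub (sa1.hasSum.mul_left (x : ℂ)))
  have hR := (((sf2.hasSum.mul_left (x * (1 + 2 * ρ * x) : ℂ)).add hd).add sf.hasSum).sub
    sa.hasSum
  have e1 := hL.unique (hR.congr_fun fun n => by
    have e : ((2 * ρ + 2) * x * rowSum p x (n + 1) - x * p 0 (n + 1) : ℂ) =
      x * (1 + 2 * ρ * x) * rowSum p x (n + 2) + diagRate ρ n * x * rowSum p x n
        + rowSum p x n - p 0 n := by exact_mod_cast h.rowSum_succ hx0 hx1 n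
    linear_combination y ^ n * e)
  simp only [zero_add] at ea ef ef1
  rw [ef] at e1
  set Ψ := ∑' n, (rowSum p x (n + 1) : ℂ) * y ^ n
  set A := ∑' n, (p 0 n : ℂ) * y ^ n
  set A1 := ∑' n, (p 0 (n + 1) : ℂ) * y ^ n
  set Ψ2 := ∑' n, (rowSum p x (n + 1 + 1) : ℂ) * y ^ n
  -- The coefficient of Ψ is the kernel, which vanishes; the boundary row equation `e0` eliminates
  -- row 1, and p 0 0 cancels.
  linear_combination (-y) * e1 + x * ea + x * (1 + 2 * ρ * x) * ef1 + x * e0 - Ψ * hk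

/-- The probability that a given queue is empty. -/
theorem tsum_boundary (h : IsFolded ρ p) : ∑' n, p 0 n = 1 - ρ := by
  have ha := h.summable_snd 0
  have hg := h.hasSum_rowSum
  have hg1 := (summable_nat_add_iff 1).2 hg.summable
  set G := ∑' n, rowSum p 1 (n + 1) with hG
  have E1 : 2 * ρ * G = (1 + ρ) * rowSum p 1 0 - ∑' n, p 0 n := by
    have e1 : (2 * ρ + 1) * ∑' n, rowSum p 1 (n + 2) = G - ∑' n, p 0 (n + 1) := by
      rw [← tsum_mul_left, hG, ← hg1.tsum_sub ((summable_nat_add_iff 1).2 ha)]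
      exact tsum_congr h.rowSum_cut
    have e2 : G = rowSum p 1 1 + ∑' n, rowSum p 1 (n + 2) := by
      rw [hG, hg1.tsum_eq_zero_add]
    have e3 := h.rowSum_zero zero_le_one le_rfl
    have e4 := ha.tsum_eq_zero_add
    linear_combination e1 + (2 * ρ + 1) * e2 + e3 + e4
  have hi : Function.Injective fun v : ℕ × ℕ => (v.1, v.2 + 1) := by
    rintro ⟨a, b⟩ ⟨c, d⟩ h
    simpa using h
  have hsum1 : Summable fun v : ℕ × ℕ => p v.1 (v.2 + 1) := h.summable.comp_injective hi
  have hs1 : ∀ m, Summable fun n => p m (n + 1) := fun m =>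
    (summable_nat_add_iff 1).2 (h.summable_snd m)
  have hG' : HasSum (fun m => ∑' n, p m (n + 1)) (∑' v : ℕ × ℕ, p v.1 (v.2 + 1)) :=
    hsum1.hasSum.prod_fiberwise fun m => (hs1 m).hasSum
  have hGG : ∑' v : ℕ × ℕ, p v.1 (v.2 + 1) = G := by
    have hs := (Equiv.prodComm ℕ ℕ).hasSum_iff.2 hsum1.hasSum
    have := (hs.prod_fiberwise fun n => (h.summable_fst (n + 1)).hasSum).tsum_eq
    rw [← this, hG]
    exact tsum_congr fun n => (rowSum_one_eq p _).symm
  rw [hGG] at hG'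
  -- Flow balance for the shorter queue between levels m and m+1: an arrival raises it only off the
  -- diagonal.
  have hcut : ∀ m, 2 * ρ * ∑' n, p m (n + 1) = ∑' n, p (m + 1) (n + 1) + p (m + 1) 0 := by
    have hd : ∀ m, HasSum (fun n => diagRate ρ n * p m n) (ρ * p m 0) := fun m => by
      convert hasSum_single 0 (fun n hn => ?_) using 1
      · simp [diagRate]
      · simp [diagRate, hn]
    have t0 : ∀ m, ∑' n, p m n = p m 0 + ∑' n, p m (n + 1) := fun m =>
      (h.summable_snd m).tsum_eq_zero_add
    have t1 : ∀ m, ∑' n, p m (n + 1) = p m 1 + ∑' n, p m (n + 2) := fun m =>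
      (hs1 m).tsum_eq_zero_add
    have hs2 : ∀ m, Summable fun n => p m (n + 2) := fun m =>
      (summable_nat_add_iff 2).2 (h.summable_snd m)
    intro m
    induction m with
    | zero =>
      have := ((hs1 0).hasSum.mul_left (2 * ρ + 1)).unique
        ((((hd 0).add (h.summable_snd 1).hasSum).add (hs2 0).hasSum).congr_fun h.zero_succ)
      rw [zero_add]
      linear_combination this + t0 1 - t1 0 + h.zero_zero
    | succ k ih =>
      have := ((hs1 (k + 1)).hasSum.mul_left (2 * ρ + 2)).unique
        (((((hs2 k).hasSum.mul_left (2 * ρ)).add (hd (k + 1))).add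
          (h.summable_snd (k + 2)).hasSum).add (hs2 (k + 1)).hasSum |>.congr_fun (h.succ_succ k))
      linear_combination this + t0 (k + 2) - t1 (k + 1) - 2 * ρ * t1 k + ih + h.succ_zero k
  have E2 : 2 * ρ * G = G + rowSum p 1 0 - ∑' n, p 0 n := by
    have k1 := hG'.mul_left (2 * ρ)
    have e1 := hG'.summable.tsum_eq_zero_add
    have e2 := (h.summable_fst 0).tsum_eq_zero_add
    have e3 : 2 * ρ * G = ∑' m, ∑' n, p (m + 1) (n + 1) + ∑' m, p (m + 1) 0 := by
      rw [← k1.tsum_eq, ← ((summable_nat_add_iff 1).2 hG'.summable).tsum_add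
        ((summable_nat_add_iff 1).2 (h.summable_fst 0))]
      exact tsum_congr hcut
    have e4 := (h.summable_snd 0).tsum_eq_zero_add
    rw [hG'.tsum_eq] at e1
    rw [rowSum_one_eq]
    linear_combination e3 + e4 - e1 - e2
  have E3 : 2 * G + rowSum p 1 0 = 1 := by
    have t := h.total
    rw [hGG, ← hg.tsum_eq, hg.summable.tsum_eq_zero_add] at t
    linear_combination t
  -- The cuts in the difference, the cuts in the shorter queue and the total mass are three linear
  -- equations in G, row 0 and the boundary sum; G and row 0 are eliminated.
  linear_combination -E1 + 2 * E2 + (1 - ρ) * E3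

end IsFolded

/-! ### Growth of the two half-chains -/

theorem IsRecurrent.re {ρ : ℝ} {a : ℕ → ℂ} (ha : IsRecurrent ρ a) (n : ℕ) :
    ρ * ((a n).re + (a (n + 2)).re) = 2 * (1 + ρ + ρ ^ 2) * (a (n + 1)).re - (1 + ρ) := by
  have h : (ρ : ℂ) * (a n + a (n + 2)) = ((2 * (1 + ρ + ρ ^ 2) : ℝ) : ℂ) * a (n + 1)
      - ((1 + ρ : ℝ) : ℂ) := by
    push_cast; exact ha n
  simpa only [Complex.re_ofReal_mul, Complex.sub_re, Complex.add_re, Complex.ofReal_re] using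
    congrArg Complex.re h

theorem norm_ge_of_re_ge {ρ : ℝ} (hρ : 0 < ρ) {a : ℕ → ℂ} (ha : IsRecurrent ρ a)
    (h0 : (a 0).re ≤ (a 1).re) (h1 : 1 ≤ (a 1).re) (n : ℕ) :
    2 ^ n * (a 1).re ≤ ‖a (n + 1)‖ :=
  (two_pow_mul_le_of_recurrence hρ (r := fun n => (a n).re) (fun n => (ha.re n).ge) h0 h1 n).trans
    (Complex.re_le_norm _)

theorem norm_ge_of_re_le {ρ : ℝ} (hρ : 0 < ρ) {a : ℕ → ℂ} (ha : IsRecurrent ρ a)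
    (h0 : (a 1).re ≤ (a 0).re) (h1 : (a 1).re ≤ -1) (n : ℕ) :
    2 ^ n * -(a 1).re ≤ ‖a (n + 1)‖ :=
  (two_pow_mul_le_of_recurrence hρ (r := fun n => -(a n).re)
    (fun n => by linarith [ha.re n]) (by linarith) (by linarith) n).trans
    ((neg_le_abs _).trans (Complex.abs_re_le_norm _))

section growth

variable {w : ℕ → ℂ} {r : ℝ}

theorem le_norm_of_growth (hr : 0 < r) (h : ∀ n, 2 ^ n * r ≤ ‖w n‖) (n : ℕ) : r ≤ ‖w n‖ :=
  (le_mul_of_one_le_left hr.le (one_le_pow₀ one_le_two)).trans (h n)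

theorem ne_zero_of_growth (hr : 0 < r) (h : ∀ n, 2 ^ n * r ≤ ‖w n‖) (n : ℕ) : w n ≠ 0 :=
  norm_pos_iff.1 (hr.trans_le (le_norm_of_growth hr h n))

theorem summable_of_growth (hr : 0 < r) (h : ∀ n, 2 ^ n * r ≤ ‖w n‖) :
    Summable fun n => ‖(w n)⁻¹‖ := by
  refine Summable.of_nonneg_of_le (fun _ => norm_nonneg _) (fun n => ?_)
    (summable_geometric_two.mul_right r⁻¹)
  rw [norm_inv, one_div, inv_pow, ← mul_inv]
  exact inv_anti₀ (by positivity) (h n)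

theorem zeroProd_ne_zero_of_growth (hr : 0 < r) (h : ∀ n, 2 ^ n * r ≤ ‖w n‖) {y : ℂ}
    (hy : ‖y‖ < r) : zeroProd w y ≠ 0 :=
  zeroProd_ne_zero (summable_of_growth hr h) (ne_zero_of_growth hr h) fun n hn =>
    (le_norm_of_growth hr h n).not_gt (hn ▸ hy)

end growth

/-! ### The functional equation on the ellipse -/

theorem genFun_conj (π : ℕ × ℕ → ℝ) (y : ℂ) :
    genFun π (starRingEnd ℂ y) = starRingEnd ℂ (genFun π y) := by
  rw [genFun, genFun, Complex.conj_tsum]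
  exact tsum_congr fun n => by simp

theorem IsInvariantDistribution.differentiableOn_genFun {ρ : ℝ} (hρ : 0 < ρ) {π : ℕ × ℕ → ℝ}
    (h : IsInvariantDistribution ρ π) :
    DifferentiableOn ℂ (genFun π) (Metric.ball 0 (1 + ρ)) := by
  have hf := h.isFolded hρ
  refine Complex.differentiableOn_tsum_of_summable_norm
    (hf.summable_rowSum_mul_pow hρ (r := 1 + ρ) (by positivity) (by linarith))
    (fun n => by fun_prop) Metric.isOpen_ball fun n y hy => ?_
  have hp := hf.abs_boundary_le n
  rw [zero_add] at hp
  rw [norm_mul, norm_pow, Complex.norm_real]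
  exact mul_le_mul hp (pow_le_pow_left₀ (norm_nonneg _) (mem_ball_zero_iff.1 hy).le n)
    (by positivity) (hf.rowSum_nonneg zero_le_one n)

theorem IsInvariantDistribution.summable_genFun {ρ : ℝ} (hρ : 0 < ρ) {π : ℕ × ℕ → ℝ}
    (h : IsInvariantDistribution ρ π) {y : ℂ} (hy : y ∈ Metric.ball (0 : ℂ) (1 + ρ)) :
    Summable fun n => (π (0, n) : ℂ) * y ^ n := by
  have hf := h.isFolded hρ
  have := hf.summable_norm_mul_pow hρ hf.abs_boundary_le (y := y)
    (by linarith [mem_ball_zero_iff.1 hy])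
  simpa only [zero_add] using this

theorem IsInvariantDistribution.genFun_one {ρ : ℝ} (hρ : 0 < ρ) {π : ℕ × ℕ → ℝ}
    (h : IsInvariantDistribution ρ π) : genFun π 1 = 1 - ρ := by
  have := (h.isFolded hρ).tsum_boundary
  simp only [zero_add] at this
  simp only [genFun, one_pow, mul_one]
  rw [← Complex.ofReal_tsum, this]
  simp

/-- The kernel equations at y and ȳ share the value of row 0 at x = Re y/(1+ρ); eliminating it
leaves a relation between A(y) and A(ȳ). Its factor matches `hXW` because the coefficient of row 0
vanishes at x = 1/ρ², y = 1/ρ, where the other root of p_x is (2+ρ)/ρ². In the application X =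
P(y)Q(ȳ) and W = P(ȳ)Q(y). -/
theorem IsInvariantDistribution.genFun_mul_eq {ρ : ℝ} (hρ : 0 < ρ) {π : ℕ × ℕ → ℝ}
    (h : IsInvariantDistribution ρ π) {y : ℂ} (hc : (y, starRingEnd ℂ y) ∈ curve ρ)
    (hn : ‖y‖ < 1 + ρ) (hre0 : 0 ≤ y.re) (hre1 : y.re ≤ 1 + ρ) (him : y.im ≠ 0) {X W : ℂ}
    (hXW : X * (y * ((2 + ρ) / ρ ^ 2 * starRingEnd ℂ y - 1 / ρ * y)) =
      W * (starRingEnd ℂ y * ((2 + ρ) / ρ ^ 2 * y - 1 / ρ * starRingEnd ℂ y))) :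
    genFun π y * W = genFun π (starRingEnd ℂ y) * X := by
  have hρ' : (ρ : ℂ) ≠ 0 := by exact_mod_cast hρ.ne'
  have hρ1 : (1 + ρ : ℂ) ≠ 0 := by exact_mod_cast (by positivity : (1 + ρ) ≠ 0)
  have hf := h.isFolded hρ
  set z := starRingEnd ℂ y with hz
  set x : ℝ := y.re / (1 + ρ) with hx
  have hx0 : 0 ≤ x := by positivity
  have hx1 : x ≤ 1 := (div_le_one (by positivity)).2 hre1
  have hsum : y + z = 2 * (1 + ρ) * x := by
    rw [hz, Complex.add_conj, hx]
    push_cast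
    field_simp
  have hprod : y * z = (1 + 2 * ρ * x) * x := by
    rw [mem_curve_iff hρ, hsum] at hc
    have h2 : (2 * (1 + ρ) ^ 2 : ℂ) ≠ 0 := mul_ne_zero two_ne_zero (pow_ne_zero 2 hρ1)
    apply mul_left_cancel₀ h2
    linear_combination hc
  have zim : z.im = -y.im := by simp [hz]
  have hy0 : y ≠ 0 := fun hy0 => him (by simp [hy0])
  have hz0 : z ≠ 0 := by simpa [hz] using hy0
  have hzn : ‖z‖ = ‖y‖ := by simp [hz]
  have ky := hf.kernel_equation hρ hx0 hx1 hy0 (by linarith)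
    (by linear_combination y * hsum - hprod)
  have kz := hf.kernel_equation hρ hx0 hx1 hz0 (by linarith)
    (by linear_combination z * hsum - hprod)
  simp only [zero_add] at ky kz
  change genFun π y * _ + _ = 0 at ky
  change genFun π z * _ + _ = 0 at kz
  -- The three cancelled factors have real coefficients, so they cannot vanish at a nonreal y.
  have n1 : (x : ℂ) - y ≠ 0 := fun e => him (by simpa using congrArg Complex.im e)
  have n2 : z + ρ * x * z - (1 + ρ) * x ≠ 0 := fun e => by
    have e' : ((1 + ρ * x : ℝ) : ℂ) * z - (((1 + ρ) * x : ℝ) : ℂ) = 0 := by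
      push_cast
      linear_combination e
    have := congrArg Complex.im e'
    rw [Complex.sub_im, Complex.im_ofReal_mul, Complex.ofReal_im, zim, Complex.zero_im,
      sub_zero] at this
    have h1 : 1 + ρ * x ≠ 0 := by positivity
    exact him (neg_eq_zero.1 ((mul_eq_zero.1 this).resolve_left h1))
  have n3 : (2 + ρ) / ρ ^ 2 * y - 1 / ρ * z ≠ 0 := fun e => by
    have e' : (((2 + ρ) / ρ ^ 2 : ℝ) : ℂ) * y - ((1 / ρ : ℝ) : ℂ) * z = 0 := by
      push_cast
      exact e
    have := congrArg Complex.im e'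
    rw [Complex.sub_im, Complex.im_ofReal_mul, Complex.im_ofReal_mul, zim, Complex.zero_im] at this
    have h1 : (2 + ρ) / ρ ^ 2 + 1 / ρ ≠ 0 := by positivity
    exact him ((mul_eq_zero.1 (by linear_combination this :
      ((2 + ρ) / ρ ^ 2 + 1 / ρ) * y.im = 0)).resolve_left h1)
  have hA : genFun π y * ((x - y) * (z + ρ * x * z - (1 + ρ) * x)) =
      genFun π z * ((x - z) * (y + ρ * x * y - (1 + ρ) * x)) := by
    linear_combination (z + ρ * x * z - (1 + ρ) * x) * ky - (y + ρ * x * y - (1 + ρ) * x) * kz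
  have hid : ((x - y) * (z + ρ * x * z - (1 + ρ) * x)) *
        (z * ((2 + ρ) / ρ ^ 2 * y - 1 / ρ * z)) =
      ((x - z) * (y + ρ * x * y - (1 + ρ) * x)) * (y * ((2 + ρ) / ρ ^ 2 * z - 1 / ρ * y)) := by
    -- In terms of half the difference of the roots, the two sides differ by a multiple of the
    -- discriminant relation `hk`.
    obtain ⟨δ, hδ⟩ : ∃ δ, δ = y - (1 + ρ) * x := ⟨_, rfl⟩
    have ey : y = (1 + ρ) * x + δ := by rw [hδ]; ring
    have ez : z = (1 + ρ) * x - δ := by linear_combination hsum + hδ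
    have hk : δ ^ 2 = ((1 + ρ) * x) ^ 2 - (1 + 2 * ρ * x) * x := by
      rw [← hprod, ez, ey]
      ring
    rw [ey, ez]
    field_simp
    linear_combination (4 * (1 + ρ) * ((1 + ρ) * ρ * x ^ 2) * δ) * hk
  apply mul_left_cancel₀ (mul_ne_zero (mul_ne_zero n1 n2) (mul_ne_zero hz0 n3))
  linear_combination W * (z * ((2 + ρ) / ρ ^ 2 * y - 1 / ρ * z)) * hA -
    genFun π z * ((x - z) * (y + ρ * x * y - (1 + ρ) * x)) * hXW - genFun π z * X * hid

end JSQ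

/-! ### Identification of the generating function with the quotient of products -/

theorem mainTheorem3 (ρ : ℝ) (hρ0 : 0 < ρ) (hρ1 : ρ < 1)
    (u v : ℤ → ℂ)
    (hu : JSQ.IsChainFrom ρ 0 (-(1 + (ρ : ℂ)) / ρ) u)
    (hv : JSQ.IsChainFrom ρ ((2 + (ρ : ℂ)) / ρ ^ 2) (1 / (ρ : ℂ)) v) :
    -- the infinite products are meaningful: no division by zero, convergence, no pole in the disk
    (∀ n : ℕ, u ((n : ℤ) + 1) ≠ 0) ∧ (∀ n : ℕ, v (-(n : ℤ)) ≠ 0) ∧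
    (∀ y : ℂ, Multipliable (fun n : ℕ => 1 - y / u ((n : ℤ) + 1)) ∧
      Multipliable (fun n : ℕ => 1 - y / v (-(n : ℤ)))) ∧
    (∀ y : ℂ, ‖y‖ < (2 + ρ) / ρ ^ 2 → ∏' n : ℕ, (1 - y / v (-(n : ℤ))) ≠ 0) ∧
    -- the constant depends on `ρ` only and is fixed by the value at `1`
    ∃ C : ℂ,
      C * ((∏' n : ℕ, (1 - 1 / u ((n : ℤ) + 1))) / ∏' n : ℕ, (1 - 1 / v (-(n : ℤ)))) = 1 - ρ ∧
      ∀ π : ℕ × ℕ → ℝ, JSQ.IsInvariantDistribution ρ π →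
        JSQ.genFun π 1 = 1 - ρ ∧
        ∀ y : ℂ, ‖y‖ < (2 + ρ) / ρ ^ 2 →
          Summable (fun k : ℕ => (π (0, k) : ℂ) * y ^ k) ∧
          JSQ.genFun π y =
            C * ((∏' n : ℕ, (1 - y / u ((n : ℤ) + 1))) / ∏' n : ℕ, (1 - y / v (-(n : ℤ)))) := by
  set a : ℕ → ℂ := fun n => u n with ha_def
  set b : ℕ → ℂ := fun n => v (1 - n) with hb_def
  have ea : ∀ n : ℕ, u ((n : ℤ) + 1) = a (n + 1) := fun n => by simp [ha_def]
  have eb : ∀ n : ℕ, v (-(n : ℤ)) = b (n + 1) := fun n => by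
    simp only [hb_def]
    congr 1
    push_cast
    ring
  have ha : JSQ.IsRecurrent ρ a := hu.isRecurrent_forward hρ0
  have hb : JSQ.IsRecurrent ρ b := hv.isRecurrent_backward hρ0
  have a0 : a 0 = 0 := by simpa [ha_def] using hu.zero
  have a1 : a 1 = -(1 + (ρ : ℂ)) / ρ := by simpa [ha_def] using hu.one
  have b0 : b 0 = 1 / (ρ : ℂ) := by simpa [hb_def] using hv.one
  have b1 : b 1 = (2 + (ρ : ℂ)) / ρ ^ 2 := by simpa [hb_def] using hv.zero
  have a1' : a 1 = ((-(1 + ρ) / ρ : ℝ) : ℂ) := by rw [a1]; push_cast; rfl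
  have b0' : b 0 = ((1 / ρ : ℝ) : ℂ) := by rw [b0]; push_cast; rfl
  have b1' : b 1 = (((2 + ρ) / ρ ^ 2 : ℝ) : ℂ) := by rw [b1]; push_cast; rfl
  have aim : ∀ n, (a n).im = 0 := ha.im_eq_zero hρ0 (by simp [a0]) (by rw [a1', Complex.ofReal_im])
  have bim : ∀ n, (b n).im = 0 := hb.im_eq_zero hρ0 (by rw [b0', Complex.ofReal_im])
    (by rw [b1', Complex.ofReal_im])
  set R := (2 + ρ) / ρ ^ 2 with hR
  have hR0 : 0 < R := by positivity
  have hr0 : 0 < (1 + ρ) / ρ := by positivity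
  -- Both products are free of zeros on the disc of radius 1 + ρ; for the numerator this needs ρ <
  -- 1.
  have hr1 : 1 + ρ < (1 + ρ) / ρ := by rw [lt_div_iff₀ hρ0]; nlinarith
  have hR1 : 1 + ρ < R := by rw [hR, lt_div_iff₀ (by positivity)]; nlinarith
  have hR2 : 1 / ρ ≤ R := by rw [hR, div_le_div_iff₀ hρ0 (by positivity)]; nlinarith
  have ga : ∀ n, 2 ^ n * ((1 + ρ) / ρ) ≤ ‖a (n + 1)‖ := by
    have e : -(a 1).re = (1 + ρ) / ρ := by rw [a1', Complex.ofReal_re]; ring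
    rw [← e]
    exact JSQ.norm_ge_of_re_le hρ0 ha (by rw [a0, Complex.zero_re]; linarith) (by linarith)
  have gb : ∀ n, 2 ^ n * R ≤ ‖b (n + 1)‖ := by
    have e : (b 1).re = R := by rw [b1', Complex.ofReal_re]
    rw [← e]
    exact JSQ.norm_ge_of_re_ge hρ0 hb (by rw [e, b0', Complex.ofReal_re]; exact hR2) (by linarith)
  have sa := JSQ.summable_of_growth hr0 ga
  have sb := JSQ.summable_of_growth hR0 gb
  have na := JSQ.ne_zero_of_growth hr0 ga
  have nb := JSQ.ne_zero_of_growth hR0 gb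
  set P := JSQ.zeroProd fun n => a (n + 1) with hP
  set Q := JSQ.zeroProd fun n => b (n + 1) with hQ
  have eP : ∀ y, ∏' n : ℕ, (1 - y / u ((n : ℤ) + 1)) = P y := fun y => by
    simp only [ea, hP, JSQ.zeroProd]
  have eQ : ∀ y, ∏' n : ℕ, (1 - y / v (-(n : ℤ))) = Q y := fun y => by
    simp only [eb, hQ, JSQ.zeroProd]
  have Q0 : ∀ y, ‖y‖ < R → Q y ≠ 0 := fun y hy => JSQ.zeroProd_ne_zero_of_growth hR0 gb hy
  have P0 : ∀ y, ‖y‖ < (1 + ρ) / ρ → P y ≠ 0 := fun y hy =>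
    JSQ.zeroProd_ne_zero_of_growth hr0 ga hy
  have one_mem : (1 : ℂ) ∈ Metric.ball (0 : ℂ) (1 + ρ) := by simpa using hρ0
  have ball_norm : ∀ {y : ℂ}, y ∈ Metric.ball (0 : ℂ) (1 + ρ) → ‖y‖ < 1 + ρ :=
    fun hy => mem_ball_zero_iff.1 hy
  set B : ℂ → ℂ := fun y => P y / Q y with hB
  have hB0 : ∀ y ∈ Metric.ball (0 : ℂ) (1 + ρ), B y ≠ 0 := fun y hy =>
    div_ne_zero (P0 y ((ball_norm hy).trans hr1)) (Q0 y ((ball_norm hy).trans hR1))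
  have hBd : DifferentiableOn ℂ B (Metric.ball 0 R) :=
    (JSQ.differentiable_zeroProd sa).differentiableOn.div
      (JSQ.differentiable_zeroProd sb).differentiableOn fun y hy => Q0 y (mem_ball_zero_iff.1 hy)
  have hBc : ∀ y, B (starRingEnd ℂ y) = starRingEnd ℂ (B y) := fun y => by
    simp only [hB, hP, hQ, map_div₀, JSQ.zeroProd_conj sa (fun n => aim _),
      JSQ.zeroProd_conj sb (fun n => bim _)]
  have hbc : (b 0, b 1) ∈ JSQ.curve ρ := by
    have := (JSQ.start_mem_curve hρ0).2
    rw [JSQ.mem_curve_iff hρ0] at this ⊢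
    rw [b0, b1]
    linear_combination this
  simp only [eP, eQ]
  -- The constant (1 − ρ)/B(1) is chosen before π, so it depends on ρ only.
  refine ⟨fun n => by rw [ea]; exact na n, fun n => by rw [eb]; exact nb n, fun y => ⟨?_, ?_⟩,
    Q0, (1 - ρ) / B 1, div_mul_cancel₀ _ (hB0 1 one_mem), fun π hπ => ⟨hπ.genFun_one hρ0, ?_⟩⟩
  · simp only [ea]
    exact JSQ.multipliable_one_sub_div sa y
  · simp only [eb]
    exact JSQ.multipliable_one_sub_div sb y
  obtain ⟨C, hC⟩ := JSQ.eq_const_mul_of_ellipse hρ0 hρ1 (hπ.differentiableOn_genFun hρ0)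
    (hBd.mono (Metric.ball_subset_ball hR1.le)) hB0 (fun y _ => JSQ.genFun_conj π y)
    (fun y _ => hBc y) (fun y hc hn h0 h1 him => by
      have hXW := JSQ.zeroProd_functional_equation hρ0 ha hb a0 a1 hbc na nb sa sb hc
      rw [b0, b1] at hXW
      have := hπ.genFun_mul_eq hρ0 hc hn h0 h1 him hXW
      have q1 := Q0 y (hn.trans hR1)
      have q2 := Q0 (starRingEnd ℂ y) (by rw [Complex.norm_conj]; exact hn.trans hR1)
      simp only [hB]
      rw [mul_div_assoc', mul_div_assoc', div_eq_div_iff q2 q1]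
      linear_combination this)
  have hC1 : C = (1 - ρ) / B 1 := by
    rw [eq_div_iff (hB0 1 one_mem), ← hC 1 one_mem, hπ.genFun_one hρ0]
  intro y hy
  -- The identity A = C·B on the small disc passes to the disc of radius R, where B is holomorphic.
  have hs := JSQ.hasSum_of_eqOn_ball (a := fun n => (π (0, n) : ℂ)) (F := fun y => C * B y)
    (r := 1 + ρ) (by positivity) (hBd.const_mul C)
    (fun y hy => by
      rw [← hC y hy]
      exact (hπ.summable_genFun hρ0 hy).hasSum)
    (mem_ball_zero_iff.2 hy)
  rw [← hC1]
  exact ⟨hs.summable, hs.tsum_eq⟩
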